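/- Let $n\ge 1$, $G=SL_n(\mathbb C)$, with center $Z$, upper triangular Borel subgroup $B$, diagonal torus $T$, and let $\mathfrak u$ be the Lie algebra of strictly upper triangular matrices, on which $B$ acts by conjugation. For a closed subgroup $H\subseteq G$ and an $H$-variety $M$, let $G\times^H M$ be the quotient of $G\times M$ by $(g,m)h=(gh,h^{-1}m)$, with classes $[g,m]$. Put $\tilde{\mathcal N}=G\times^B\mathfrak u$. Let $\alpha_1,\dots,\alpha_{n-1}$ be the simple roots, let $\mathcal V_{ad}=\mathfrak u/[\mathfrak u,\mathfrak u]$ (with coordinates the entries just above the diagonal), let $p:\mathfrak u\to\mathcal V_{ad}$ be the projection, and let $\mathcal V=\operatorname{Spec}\mathbb C[S]$ be the affine toric variety of $T$, where $S$ is the monoid of characters of $T$ lying in the real cone spanned by the simple roots. Let $\pi:\mathcal V\to\mathcal V_{ad}=\mathcal V/Z$ be the map given by the coordinate functions of $\alpha_1,\dots,\alpha_{n-1}$. Let $B$ act on $\mathcal V$ through $B\to B/U\cong T$, where $U\subset B$ is the subgroup of unipotent matrices, and set $\tilde{\mathfrak u}=\mathcal V\times_{\mathcal V_{ad}}\mathfrak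 u$, $\tilde{\mathcal M}=G\times^B\tilde{\mathfrak u}$, and $\tilde\eta:\tilde{\mathcal M}\to\tilde{\mathcal N}=\tilde{\mathcal M}/Z$, $[g,(v,y)]\mapsto[g,y]$. For a character $\chi:Z\to\mathbb C^*$ let $\tilde{\mathcal M}_\chi=\{m\in\tilde{\mathcal M}\mid Z^m\subseteq\ker\chi\}$, where $Z^m$ is the stabilizer of $m$ in $Z\subseteq G$, and $\tilde{\mathcal N}_\chi=\tilde{\mathcal M}_\chi/Z=\tilde\eta(\tilde{\mathcal M}_\chi)$. Suppose that $\chi$ has order $d$ (so $d\mid n$). Let $P=P_d$ be the group of block upper triangular matrices in $G$ with $d\times d$ blocks, $L$ its block diagonal Levi subgroup, $\mathfrak u_P$ the Lie algebra of strictly block upper triangular matrices, $\mathcal N_L$ the nilpotent cone of $\mathfrak l=\operatorname{Lie}L$, and $\mathcal O_L^{pr}$ the principal nilpotent orbit, i.e. the dense $L$-orbit in $\mathcal N_L$. Let $\tilde{\mathcal N}^P=G\times^P(\mathcal N_L+\mathfrak u_P)$, let $\tilde{\mathcal N}^P_{reg}=G\times^P(\mathcal O_L^{pr}+\mathfrak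 u_P)\subseteq\tilde{\mathcal N}^P$, and let $\rho_P:\tilde{\mathcal N}\to\tilde{\mathcal N}^P$ be the map $[g,x]_B\mapsto[g,x]_P$. Then $\rho_P^{-1}(\tilde{\mathcal N}^P_{reg})=\tilde{\mathcal N}_\chi$, and $\rho_P$ maps $\tilde{\mathcal N}_\chi$ isomorphically, as varieties, onto $\tilde{\mathcal N}^P_{reg}$. -/

import Mathlib

open scoped Pointwise Topology

noncomputable section

namespace ExtendedSpringer

/-! ### Varieties as spaces with functions

All schemes that occur are varieties over `ℂ`; such a variety is determined by its closed points,
its Zariski topology and its regular functions. -/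

/-- A space with functions: a topology on `X`, and for every open `U` the functions that are
regular on `U`. Functions on `U` are written as functions on `X`; only the values on `U` matter. -/
structure SpaceWithFunctions (X : Type*) where
  top : TopologicalSpace X
  IsRegularOn : Set X → (X → ℂ) → Prop

namespace SpaceWithFunctions

/-- The structure of a (locally closed) subset `X` of an affine space with coordinates `c`:
the Zariski topology, and the functions that locally are quotients of polynomials. -/
def zariski {X σ : Type*} (c : X → σ → ℂ) : SpaceWithFunctions X where
  top := TopologicalSpace.generateFrom
    {D | ∃ q : MvPolynomial σ ℂ, D = {x | MvPolynomial.eval (c x) q ≠ 0}}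
  IsRegularOn U f := ∀ x ∈ U, ∃ p q : MvPolynomial σ ℂ, MvPolynomial.eval (c x) q ≠ 0 ∧
    ∀ y ∈ U, MvPolynomial.eval (c y) q ≠ 0 →
      f y = MvPolynomial.eval (c y) p / MvPolynomial.eval (c y) q

/-- The quotient structure along `π`: a set is open, respectively a function is regular,
if and only if its pullback along `π` is. -/
def quotient {X Y : Type*} (S : SpaceWithFunctions X) (π : X → Y) : SpaceWithFunctions Y where
  top := S.top.coinduced π
  IsRegularOn U f := S.IsRegularOn (π ⁻¹' U) (f ∘ π)

/-- The structure induced on a (locally closed) subset: the subspace topology, and the functions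
that locally are restrictions of regular functions of the ambient space. -/
def induced {X : Type*} (S : SpaceWithFunctions X) (A : Set X) : SpaceWithFunctions A where
  top := S.top.induced Subtype.val
  IsRegularOn U f := ∀ x ∈ U, ∃ (W : Set X) (F : X → ℂ), IsOpen[S.top] W ∧ (x : X) ∈ W ∧
    S.IsRegularOn W F ∧ ∀ y ∈ U, (y : X) ∈ W → f y = F y

/-- A morphism is a continuous map along which regular functions pull back to regular ones. -/
def IsMorphism {X Y : Type*} (S : SpaceWithFunctions X) (T : SpaceWithFunctions Y)
    (φ : X → Y) : Prop :=
  ∀ V : Set Y, IsOpen[T.top] V → IsOpen[S.top] (φ ⁻¹' V) ∧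
    ∀ f : Y → ℂ, T.IsRegularOn V f → S.IsRegularOn (φ ⁻¹' V) (f ∘ φ)

/-- An isomorphism is a morphism that has an inverse morphism. -/
def IsIsomorphism {X Y : Type*} (S : SpaceWithFunctions X) (T : SpaceWithFunctions Y)
    (φ : X → Y) : Prop :=
  IsMorphism S T φ ∧
    ∃ ψ : Y → X, Function.LeftInverse ψ φ ∧ Function.RightInverse ψ φ ∧ IsMorphism T S ψ

/-- `φ` maps the subvariety `A` isomorphically onto the subvariety `A'`. -/
def MapsIsomorphicallyOnto {X Y : Type*} (S : SpaceWithFunctions X) (T : SpaceWithFunctions Y)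
    (φ : X → Y) (A : Set X) (A' : Set Y) : Prop :=
  ∃ h : Set.MapsTo φ A A', IsIsomorphism (S.induced A) (T.induced A') h.restrict

end SpaceWithFunctions

/-! ### Mixed spaces -/

/-- The relation on `G × M` whose classes are the orbits of `(g, m) h = (g h, h⁻¹ m)`, `h ∈ H`. -/
def mixedSetoid {G : Type*} [Group G] (H : Subgroup G) (M : Type*) [MulAction H M] :
    Setoid (G × M) where
  r a b := ∃ h : H, b = (a.1 * h, h⁻¹ • a.2)
  iseqv :=
    { refl := fun a => ⟨1, by simp⟩
      symm := by
        rintro a b ⟨h, rfl⟩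
        exact ⟨h⁻¹, by simp⟩
      trans := by
        rintro a b c ⟨h, rfl⟩ ⟨k, rfl⟩
        exact ⟨h * k, by simp [mul_assoc, mul_smul]⟩ }

/-- The mixed space `G ×^H M`. -/
def Mixed {G : Type*} [Group G] (H : Subgroup G) (M : Type*) [MulAction H M] : Type _ :=
  Quotient (mixedSetoid H M)

/-- The class `[g, m]` in `G ×^H M`. -/
def Mixed.mk {G : Type*} [Group G] (H : Subgroup G) {M : Type*} [MulAction H M]
    (p : G × M) : Mixed H M :=
  Quotient.mk (mixedSetoid H M) p

/-- The left action `g [g', m] = [g g', m]` of `G` on `G ×^H M`. -/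
instance {G : Type*} [Group G] (H : Subgroup G) (M : Type*) [MulAction H M] :
    MulAction G (Mixed H M) where
  smul g := Quotient.map (fun a => (g * a.1, a.2)) (by
    rintro a b ⟨h, rfl⟩
    exact ⟨h, by simp [mul_assoc]⟩)
  one_smul := by
    rintro ⟨a⟩
    exact congrArg (Mixed.mk H) (by simp)
  mul_smul := by
    rintro g g' ⟨a⟩
    exact congrArg (Mixed.mk H) (by simp [mul_assoc])

/-- The map `G ×^H M → G ×^K N`, `[g, m] ↦ [g, f m]`, for `H ≤ K` and an `H`-equivariant `f`. -/
def Mixed.map {G : Type*} [Group G] {H K : Subgroup G} (hHK : H ≤ K) {M N : Type*}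
    [MulAction H M] [MulAction K N] (f : M → N)
    (hf : ∀ (h : H) (m : M), f (h • m) = (⟨h, hHK h.2⟩ : K) • f m) : Mixed H M → Mixed K N :=
  Quotient.map (fun a => (a.1, f a.2)) (by
    rintro a b ⟨h, rfl⟩
    exact ⟨⟨h, hHK h.2⟩, Prod.ext rfl (hf h⁻¹ a.2)⟩)

/-! ### Subgroups of `SL_n` and subsets of its Lie algebra -/

/-- `n × n` matrices. Rows and columns are numbered `0, …, n - 1`. -/
abbrev Mat (n : ℕ) := Matrix (Fin n) (Fin n) ℂ

/-- `SL_n(ℂ)`. -/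
abbrev SL (n : ℕ) := Matrix.SpecialLinearGroup (Fin n) ℂ

/-- The adjoint action `g · x = g x g⁻¹`. -/
def Ad {n : ℕ} (g : SL n) (x : Mat n) : Mat n := (g : Mat n) * x * ((g⁻¹ : SL n) : Mat n)

lemma Ad_one {n : ℕ} (x : Mat n) : Ad 1 x = x := by simp [Ad]

lemma Ad_mul {n : ℕ} (g h : SL n) (x : Mat n) : Ad (g * h) x = Ad g (Ad h x) := by
  simp only [Ad, mul_inv_rev, Matrix.SpecialLinearGroup.coe_mul, mul_assoc]

lemma coe_inv_eq {n : ℕ} (g : SL n) : ((g⁻¹ : SL n) : Mat n) = (g : Mat n)⁻¹ := by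
  simp [Matrix.inv_def, g.2]

lemma coe_mul_inv {n : ℕ} (g : SL n) : (g : Mat n) * ((g⁻¹ : SL n) : Mat n) = 1 := by
  rw [← Matrix.SpecialLinearGroup.coe_mul, mul_inv_cancel, Matrix.SpecialLinearGroup.coe_one]

lemma coe_inv_mul {n : ℕ} (g : SL n) : ((g⁻¹ : SL n) : Mat n) * (g : Mat n) = 1 := by
  rw [← Matrix.SpecialLinearGroup.coe_mul, inv_mul_cancel, Matrix.SpecialLinearGroup.coe_one]

/-- The block upper triangular matrices in `SL_n`, where `b i` is the block containing `i`:
`g i j = 0` whenever `b j < b i`. -/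
def blockUpper {n : ℕ} {α : Type*} [LinearOrder α] (b : Fin n → α) : Subgroup (SL n) where
  carrier := {g | (g : Mat n).BlockTriangular b}
  one_mem' := by
    simpa using Matrix.blockTriangular_one
  mul_mem' := by
    intro g h hg hh
    simpa using Matrix.BlockTriangular.mul hg hh
  inv_mem' := by
    intro g hg
    have : Invertible (g : Mat n) := ⟨_, coe_inv_mul g, coe_mul_inv g⟩
    change ((g⁻¹ : SL n) : Mat n).BlockTriangular b
    rw [coe_inv_eq]
    exact Matrix.blockTriangular_inv_of_blockTriangular hg

/-- The Borel subgroup `B` of upper triangular matrices. -/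
def borel (n : ℕ) : Subgroup (SL n) := blockUpper (fun i : Fin n => (i : ℕ))

/-- The block of size `d` that contains the index `i`. -/
def blk {n : ℕ} (d : ℕ) (i : Fin n) : ℕ := (i : ℕ) / d

/-- The standard parabolic `P_d` of block upper triangular matrices with `d × d` blocks. -/
def parabolic (n d : ℕ) : Subgroup (SL n) := blockUpper (blk (n := n) d)

/-- The Levi subgroup `L_d` of block diagonal matrices with `d × d` blocks: the matrices that are
both block upper and block lower triangular. -/
def levi (n d : ℕ) : Subgroup (SL n) :=
  blockUpper (blk (n := n) d) ⊓ blockUpper (fun i : Fin n => OrderDual.toDual (blk d i))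

/-- The Lie algebra `𝔲` of strictly upper triangular matrices. -/
def nilradical (n : ℕ) : Set (Mat n) := {x | ∀ i j, j ≤ i → x i j = 0}

/-- The Lie algebra `𝔲_P` of strictly block upper triangular matrices. -/
def nilradicalP (n d : ℕ) : Set (Mat n) := {x | ∀ i j, blk d j ≤ blk d i → x i j = 0}

/-- The Lie algebra `𝔩` of block diagonal matrices of trace zero. -/
def leviAlgebra (n d : ℕ) : Set (Mat n) :=
  {x | (∀ i j, blk d i ≠ blk d j → x i j = 0) ∧ x.trace = 0}

/-- The nilpotent cone `𝒩_L` of `𝔩`. -/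
def nilconeL (n d : ℕ) : Set (Mat n) := {x | x ∈ leviAlgebra n d ∧ IsNilpotent x}

/-- The matrix entries, as coordinates on the affine space of matrices. -/
def entries {n : ℕ} (x : Mat n) : Fin n × Fin n → ℂ := fun p => x p.1 p.2

/-- The principal nilpotent orbit `𝒪_L^pr` of `L`: the elements of `𝒩_L` whose `L`-orbit is
Zariski dense in `𝒩_L`. -/
def principalOrbitL (n d : ℕ) : Set (Mat n) :=
  {y | y ∈ nilconeL n d ∧ nilconeL n d ⊆
    @closure _ (SpaceWithFunctions.zariski (entries (n := n))).top {x | ∃ l ∈ levi n d, x = Ad l y}}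

/-- The block diagonal part of a matrix. -/
def diagPart {n : ℕ} (d : ℕ) (x : Mat n) : Mat n :=
  Matrix.of fun i j => if blk d i = blk d j then x i j else 0

lemma diagPart_mul {n d : ℕ} {x y : Mat n} (hx : x.BlockTriangular (blk d))
    (hy : y.BlockTriangular (blk d)) : diagPart d (x * y) = diagPart d x * diagPart d y := by
  ext i j
  simp only [diagPart, Matrix.of_apply, Matrix.mul_apply]
  split_ifs with h
  · refine Finset.sum_congr rfl fun k _ => ?_
    rcases lt_trichotomy (blk d i) (blk d k) with hk | hk | hk
    · simp [hy (show blk d j < blk d k by omega), hk.ne]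
    · simp [hk, ← h]
    · simp [hx hk, hk.ne']
  · refine (Finset.sum_eq_zero fun k _ => ?_).symm
    by_cases hk : blk d i = blk d k
    · simp [← hk, h]
    · simp [hk]

lemma diagPart_one {n d : ℕ} : diagPart d (1 : Mat n) = 1 := by
  ext i j
  by_cases h : i = j
  · subst h; simp [diagPart]
  · simp [diagPart, h]

lemma mem_add_iff {n d : ℕ} (x : Mat n) : x ∈ nilconeL n d + nilradicalP n d ↔
    x.BlockTriangular (blk d) ∧ IsNilpotent (diagPart d x) := by
  constructor
  · rintro ⟨y, ⟨⟨hy, -⟩, hn⟩, w, hw, rfl⟩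
    have e : diagPart d (y + w) = y := by
      ext i j
      simp only [diagPart, Matrix.of_apply, Matrix.add_apply]
      split_ifs with h
      · simp [hw i j h.ge]
      · exact (hy i j h).symm
    refine ⟨fun i j h => ?_, by rwa [e]⟩
    simp [hy i j h.ne', hw i j h.le]
  · rintro ⟨hx, hn⟩
    refine ⟨diagPart d x, ⟨⟨fun i j h => by simp [diagPart, h], ?_⟩, hn⟩, x - diagPart d x,
      fun i j h => ?_, by simp⟩
    · exact (Matrix.isNilpotent_trace_of_isNilpotent hn).eq_zero
    · rcases h.lt_or_eq with h | h
      · simp [diagPart, hx h, h.ne']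
      · simp [diagPart, h]

/-- `𝒩_L + 𝔲_P` is stable under `P`. -/
lemma Ad_mem_add {n d : ℕ} {g : SL n} (hg : g ∈ parabolic n d) {x : Mat n}
    (hx : x ∈ nilconeL n d + nilradicalP n d) : Ad g x ∈ nilconeL n d + nilradicalP n d := by
  rw [mem_add_iff] at hx ⊢
  obtain ⟨hb, k, hk⟩ := hx
  have hg' : (g : Mat n).BlockTriangular (blk d) := hg
  have hi : ((g⁻¹ : SL n) : Mat n).BlockTriangular (blk d) := inv_mem hg
  refine ⟨(hg'.mul hb).mul hi, k, ?_⟩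
  have h1 : diagPart d ((g⁻¹ : SL n) : Mat n) * diagPart d (g : Mat n) = 1 := by
    rw [← diagPart_mul hi hg', coe_inv_mul, diagPart_one]
  have h2 : diagPart d (g : Mat n) * diagPart d ((g⁻¹ : SL n) : Mat n) = 1 := by
    rw [← diagPart_mul hg' hi, coe_mul_inv, diagPart_one]
  rw [Ad, diagPart_mul (hg'.mul hb) hi, diagPart_mul hg' hb]
  have := Units.conj_pow (⟨_, _, h2, h1⟩ : (Mat n)ˣ) (diagPart d x) k
  simp only [Units.inv_mk] at this
  rw [this, hk]
  simp

/-- `𝔲` is stable under `B`. -/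
lemma Ad_mem_nilradical {n : ℕ} {g : SL n} (hg : g ∈ borel n) {x : Mat n}
    (hx : x ∈ nilradical n) : Ad g x ∈ nilradical n := by
  have hi : ((g⁻¹ : SL n) : Mat n).BlockTriangular (fun i : Fin n => (i : ℕ)) := inv_mem hg
  have hg' : (g : Mat n).BlockTriangular (fun i : Fin n => (i : ℕ)) := hg
  intro i j hij
  rw [Ad, Matrix.mul_apply]
  refine Finset.sum_eq_zero fun k _ => ?_
  by_cases hk : j < k
  · rw [hi hk, mul_zero]
  · rw [Matrix.mul_apply, Finset.sum_eq_zero, zero_mul]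
    intro l _
    by_cases hl : l < i
    · rw [hg' hl, zero_mul]
    · rw [hx l k (by omega), mul_zero]

lemma nilradical_subset (n d : ℕ) : nilradical n ⊆ nilconeL n d + nilradicalP n d := by
  intro x hx
  rw [mem_add_iff]
  refine ⟨fun i j h => hx i j ?_, ?_⟩
  · by_contra hij
    exact absurd (Nat.div_le_div_right (c := d) (show (i : ℕ) ≤ j by omega)) (not_le.2 h)
  · have hD : diagPart d x ∈ nilradical n := by
      intro i j hij
      simp [diagPart, hx i j hij]
    refine ⟨n, ?_⟩
    have hc := Matrix.charpoly_of_isUpperTriangular (M := diagPart d x)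
      (fun i j h => hD i j (le_of_lt h))
    have := Matrix.aeval_self_charpoly (diagPart d x)
    rw [hc] at this
    simpa [hD _ _ le_rfl] using this

lemma borel_le_parabolic (n d : ℕ) : borel n ≤ parabolic n d := by
  intro g hg i j h
  refine hg (show (j : ℕ) < i from ?_)
  by_contra hij
  exact absurd (Nat.div_le_div_right (c := d) (show (i : ℕ) ≤ j by omega)) (not_le.2 h)

/-- The adjoint action of `B` on `𝔲`. -/
instance (n : ℕ) : MulAction (borel n) (nilradical n) where
  smul g x := ⟨Ad g x, Ad_mem_nilradical g.2 x.2⟩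
  one_smul _ := Subtype.ext (Ad_one _)
  mul_smul _ _ _ := Subtype.ext (Ad_mul _ _ _)

/-- The adjoint action of `P` on `𝒩_L + 𝔲_P`. -/
instance (n d : ℕ) :
    MulAction (parabolic n d) (nilconeL n d + nilradicalP n d : Set (Mat n)) where
  smul g x := ⟨Ad g x, Ad_mem_add g.2 x.2⟩
  one_smul _ := Subtype.ext (Ad_one _)
  mul_smul _ _ _ := Subtype.ext (Ad_mul _ _ _)

/-! ### The varieties `Ñ` and `Ñ^P` and the map between them -/

/-- `Ñ = G ×^B 𝔲`. -/
abbrev NTilde (n : ℕ) := Mixed (borel n) (nilradical n)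

/-- `Ñ^P = G ×^P (𝒩_L + 𝔲_P)`. -/
abbrev NTildeP (n d : ℕ) :=
  Mixed (parabolic n d) (nilconeL n d + nilradicalP n d : Set (Mat n))

/-- `G × A`, for a set `A` of matrices, as a subset of the affine space of pairs of matrices. -/
def pairEntries {n : ℕ} {A : Set (Mat n)} (p : SL n × A) :
    (Fin n × Fin n) ⊕ (Fin n × Fin n) → ℂ :=
  Sum.elim (entries (p.1 : Mat n)) (entries (p.2 : Mat n))

/-- `Ñ` as a variety, the quotient of `G × 𝔲` by `B`. -/
def varietyNTilde (n : ℕ) : SpaceWithFunctions (NTilde n) :=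
  (SpaceWithFunctions.zariski pairEntries).quotient (Mixed.mk (borel n))

/-- `Ñ^P` as a variety, the quotient of `G × (𝒩_L + 𝔲_P)` by `P`. -/
def varietyNTildeP (n d : ℕ) : SpaceWithFunctions (NTildeP n d) :=
  (SpaceWithFunctions.zariski pairEntries).quotient (Mixed.mk (parabolic n d))

/-- `ρ_P : Ñ → Ñ^P`, `[g, x]_B ↦ [g, x]_P`. -/
def rhoP (n d : ℕ) : NTilde n → NTildeP n d :=
  Mixed.map (borel_le_parabolic n d) (Set.inclusion (nilradical_subset n d)) fun _ _ => rfl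

/-- The stratum `Ñ^P_reg = G ×^P (𝒪_L^pr + 𝔲_P)`. -/
def NTildePReg (n d : ℕ) : Set (NTildeP n d) :=
  {z | ∃ (g : SL n) (x : (nilconeL n d + nilradicalP n d : Set (Mat n))),
    (x : Mat n) ∈ principalOrbitL n d + nilradicalP n d ∧ z = Mixed.mk (parabolic n d) (g, x)}

/-! ### The toric variety `𝒱` and the extended Springer resolution -/

/-- The maximal torus `T` of diagonal matrices in `SL_n`. -/
def torus (n : ℕ) : Subgroup (SL n) where
  carrier := {g | (g : Mat n).IsDiag}
  one_mem' := by simp [Matrix.isDiag_one]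
  mul_mem' := by
    intro g h hg hh i j hij
    rw [Matrix.SpecialLinearGroup.coe_mul, Matrix.mul_apply]
    refine Finset.sum_eq_zero fun k _ => ?_
    by_cases hk : i = k
    · rw [hh (show k ≠ j from hk ▸ hij), mul_zero]
    · rw [hg hk, zero_mul]
  inv_mem' := by
    intro g hg i j hij
    have h := congrFun (congrFun (coe_mul_inv g) i) j
    have h0 := congrFun (congrFun (coe_mul_inv g) i) i
    rw [Matrix.mul_apply, Finset.sum_eq_single i] at h h0
    · rw [Matrix.one_apply_ne hij] at h
      rw [Matrix.one_apply_eq] at h0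
      exact (mul_eq_zero.1 h).resolve_left (left_ne_zero_of_mul_eq_one h0)
    all_goals first
      | (intro k _ hk; rw [hg (Ne.symm hk), zero_mul])
      | (intro hk; exact absurd (Finset.mem_univ _) hk)

/-- The character `t ↦ t i i` of `T`. -/
def eps {n : ℕ} (i : Fin n) : torus n →* ℂˣ :=
  MonoidHom.toHomUnits
    { toFun := fun t => (t : SL n) i i
      map_one' := by simp
      map_mul' := by
        intro s t
        rw [Subgroup.coe_mul, Matrix.SpecialLinearGroup.coe_mul, Matrix.mul_apply,
          Finset.sum_eq_single i]
        · intro k _ hk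
          rw [s.2 (Ne.symm hk), zero_mul]
        · intro hk
          exact absurd (Finset.mem_univ _) hk }

/-- The character `t ↦ ∏ i, (t i i) ^ (a i)`. Every (algebraic) character of `T` is of this form,
and `a` is determined up to adding a constant vector. -/
def weight {n : ℕ} (a : Fin n → ℤ) : torus n →* ℂˣ := ∏ i, eps i ^ a i

/-- The exponent vector of the simple root `ε_k - ε_{k+1}`; since indices start at `0`, the root
with index `k : Fin (n - 1)` is `α_{k+1}` in the usual numbering `α_1, …, α_{n-1}`. -/
def rootExp {n : ℕ} (k : Fin (n - 1)) : Fin n → ℤ := fun j =>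
  if (j : ℕ) = k then 1 else if (j : ℕ) = k + 1 then -1 else 0

/-- The image of `a` in the real span of the character group, which is `ℝ^n` modulo constant
vectors, is a combination of the simple roots with coefficients in `ℝ_{≥ 0}`. -/
def InRootCone {n : ℕ} (a : Fin n → ℤ) : Prop :=
  ∃ (c : Fin (n - 1) → ℝ) (s : ℝ), (∀ k, 0 ≤ c k) ∧
    ∀ j, (a j : ℝ) = s + ∑ k, c k * (rootExp k j : ℝ)

/-- The monoid of those characters of `T` that lie in the cone spanned by the simple roots. -/
def coneMonoid (n : ℕ) : Submonoid (torus n →* ℂˣ) where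
  carrier := {μ | ∃ a, InRootCone a ∧ weight a = μ}
  one_mem' := ⟨0, ⟨0, 0, by simp, by simp⟩, Finset.prod_eq_one fun i _ => zpow_zero (eps i)⟩
  mul_mem' := by
    rintro _ _ ⟨a, ⟨c, s, hc, ha⟩, rfl⟩ ⟨a', ⟨c', s', hc', ha'⟩, rfl⟩
    refine ⟨a + a', ⟨c + c', s + s', fun k => add_nonneg (hc k) (hc' k), fun j => ?_⟩, ?_⟩
    · simp only [Pi.add_apply, Int.cast_add, ha, ha', add_mul, Finset.sum_add_distrib]
      ring
    · exact (Finset.prod_congr rfl fun i _ => zpow_add (eps i) (a i) (a' i)).trans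
        Finset.prod_mul_distrib

lemma rootExp_mem {n : ℕ} (k : Fin (n - 1)) : weight (rootExp k) ∈ coneMonoid n :=
  ⟨rootExp k, ⟨Pi.single k 1, 0, fun l => by
    by_cases h : l = k
    · subst h; simp
    · simp [h], fun j => by simp [Pi.single_apply]⟩, rfl⟩

/-- The simple root with index `k`, as an element of the monoid. -/
def simpleRoot {n : ℕ} (k : Fin (n - 1)) : coneMonoid n := ⟨weight (rootExp k), rootExp_mem k⟩

/-- The affine toric variety `𝒱 = Spec ℂ[S]` for the torus `T` and the monoid `S` of characters in
the cone spanned by the simple roots. Its points are the `ℂ`-algebra maps `ℂ[S] → ℂ`, that is, the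
monoid maps `S → (ℂ, ·)`. -/
structure ToricV (n : ℕ) where
  val : coneMonoid n →* ℂ

/-- The `T`-action on `𝒱`: `t` scales the coordinate function of the character `s` by `s t`. -/
instance (n : ℕ) : MulAction (torus n) (ToricV n) where
  smul t v := ⟨{
    toFun := fun s => ((s : torus n →* ℂˣ) t : ℂ) * v.val s
    map_one' := by simp
    map_mul' := fun s s' => by simp; ring }⟩
  one_smul v := by
    rcases v with ⟨v⟩
    exact congrArg ToricV.mk (MonoidHom.ext fun s => by simp)
  mul_smul t t' v := by
    rcases v with ⟨v⟩
    refine congrArg ToricV.mk (MonoidHom.ext fun s => ?_)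
    change (((s : torus n →* ℂˣ) (t * t') : ℂˣ) : ℂ) * v s =
      ((s : torus n →* ℂˣ) t : ℂ) * (((s : torus n →* ℂˣ) t' : ℂ) * v s)
    rw [map_mul, Units.val_mul, mul_assoc]

/-- `𝒱_ad = 𝔤_2 = 𝔲/[𝔲,𝔲]`, with one coordinate for each simple root. -/
abbrev VAd (n : ℕ) := Fin (n - 1) → ℂ

/-- `π : 𝒱 → 𝒱_ad`, given by the coordinate functions of the simple roots. -/
def piV {n : ℕ} (v : ToricV n) : VAd n := fun k => v.val (simpleRoot k)

/-- `p : 𝔲 → 𝔲/[𝔲,𝔲] = 𝒱_ad`, given by the entries just above the diagonal. -/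
def projAd {n : ℕ} (x : Mat n) : VAd n := fun k =>
  x ⟨k, by omega⟩ ⟨k + 1, by omega⟩

lemma borel_mul_diag {n : ℕ} {g h : SL n} (hg : g ∈ borel n) (hh : h ∈ borel n) (i : Fin n) :
    (g * h) i i = g i i * h i i := by
  rw [Matrix.SpecialLinearGroup.coe_mul, Matrix.mul_apply, Finset.sum_eq_single i]
  · intro k _ hk
    rcases lt_or_gt_of_ne hk with hk | hk
    · have : (g : Mat n) i k = 0 := hg (show (k : ℕ) < i from hk)
      rw [this, zero_mul]
    · have : (h : Mat n) k i = 0 := hh (show (i : ℕ) < k from hk)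
      rw [this, mul_zero]
  · intro hk
    exact absurd (Finset.mem_univ _) hk

/-- The projection `B → B/U = T` onto the diagonal part. -/
def borelToTorus (n : ℕ) : borel n →* torus n where
  toFun b := ⟨⟨Matrix.diagonal fun i => (b : SL n) i i, by
    have hb : ((b : SL n) : Mat n).BlockTriangular id := fun i j h => b.2 h
    rw [Matrix.det_diagonal, ← Matrix.det_of_isUpperTriangular hb]
    exact (b : SL n).2⟩, Matrix.isDiag_diagonal _⟩
  map_one' := by
    apply Subtype.ext
    apply Subtype.ext
    simp
  map_mul' b c := by
    apply Subtype.ext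
    apply Subtype.ext
    change Matrix.diagonal (fun i => ((b : SL n) * (c : SL n)) i i) =
      Matrix.diagonal (fun i => (b : SL n) i i) * Matrix.diagonal (fun i => (c : SL n) i i)
    rw [Matrix.diagonal_mul_diagonal]
    congr 1
    ext i
    exact borel_mul_diag b.2 c.2 i

/-- The `B`-action on `𝒱` through `B → T`. -/
instance (n : ℕ) : MulAction (borel n) (ToricV n) :=
  MulAction.compHom (ToricV n) (borelToTorus n)

lemma coe_weight {n : ℕ} (a : Fin n → ℤ) (t : torus n) :
    ((weight a t : ℂˣ) : ℂ) = ∏ i, ((t : SL n) i i) ^ a i := by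
  simp only [weight, MonoidHom.finsetProd_apply, Units.coe_prod]
  exact Finset.prod_congr rfl fun i _ => by
    change (((eps i t) ^ a i : ℂˣ) : ℂ) = _
    rw [Units.val_zpow_eq_zpow_val]
    rfl

lemma prod_rootExp {n : ℕ} (k : Fin (n - 1)) (f : Fin n → ℂ) :
    ∏ i, f i ^ rootExp k i = f ⟨k, by omega⟩ * (f ⟨k + 1, by omega⟩)⁻¹ := by
  rw [Finset.prod_eq_mul (⟨k, by omega⟩ : Fin n) ⟨k + 1, by omega⟩]
  · simp [rootExp]
  · simp
  · intro c _ hc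
    have h1 : (c : ℕ) ≠ k := fun h => hc.1 (Fin.ext h)
    have h2 : (c : ℕ) ≠ k + 1 := fun h => hc.2 (Fin.ext h)
    simp [rootExp, h1, h2]
  all_goals exact fun h => absurd (Finset.mem_univ _) h

lemma piV_smul {n : ℕ} (b : borel n) (v : ToricV n) (k : Fin (n - 1)) :
    piV (b • v) k =
      (b : SL n) ⟨k, by omega⟩ ⟨k, by omega⟩ * ((b : SL n) ⟨k + 1, by omega⟩ ⟨k + 1, by omega⟩)⁻¹
        * piV v k := by
  change ((weight (rootExp k) (borelToTorus n b) : ℂˣ) : ℂ) * piV v k = _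
  rw [coe_weight, prod_rootExp]
  simp [borelToTorus]

lemma projAd_Ad {n : ℕ} (b : borel n) {x : Mat n} (hx : x ∈ nilradical n) (k : Fin (n - 1)) :
    projAd (Ad b x) k =
      (b : SL n) ⟨k, by omega⟩ ⟨k, by omega⟩ * ((b : SL n) ⟨k + 1, by omega⟩ ⟨k + 1, by omega⟩)⁻¹
        * projAd x k := by
  set i : Fin n := ⟨k, by omega⟩ with hi
  set j : Fin n := ⟨k + 1, by omega⟩ with hj
  have hb : ∀ p q : Fin n, q < p → (b : SL n) p q = 0 := fun p q h => b.2 h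
  have hy := Ad_mem_nilradical b.2 hx
  have e : Ad b x * ((b : SL n) : Mat n) = ((b : SL n) : Mat n) * x := by
    rw [Ad, mul_assoc, coe_inv_mul, mul_one]
  have hne : (b : SL n) j j ≠ 0 := by
    have h := borel_mul_diag b.2 (inv_mem b.2) j
    rw [mul_inv_cancel] at h
    exact left_ne_zero_of_mul_eq_one (h.symm.trans (by simp))
  have e' := congrFun (congrFun e i) j
  rw [Matrix.mul_apply, Matrix.mul_apply, Finset.sum_eq_single j, Finset.sum_eq_single i] at e'
  · change Ad b x i j = _ * _ * x i j
    rw [mul_right_comm, ← e', mul_assoc, mul_inv_cancel₀ hne, mul_one]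
  · intro l _ hl
    rcases lt_or_gt_of_ne hl with h | h
    · rw [hb i l h, zero_mul]
    · rw [hx l j (show (k : ℕ) + 1 ≤ l from h), mul_zero]
  · exact fun h => absurd (Finset.mem_univ _) h
  · intro l _ hl
    rcases lt_or_gt_of_ne hl with h | h
    · rw [hy i l (show (l : ℕ) ≤ k from Nat.lt_succ_iff.1 h), zero_mul]
    · rw [hb l j h, mul_zero]
  · exact fun h => absurd (Finset.mem_univ _) h

/-- `𝔲̃ = 𝒱 ×_{𝒱_ad} 𝔲`. -/
def UTilde (n : ℕ) : Type := {p : ToricV n × nilradical n // piV p.1 = projAd (p.2 : Mat n)}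

/-- The `B`-action on `𝔲̃` that comes from the actions on `𝒱` and `𝔲`. -/
instance (n : ℕ) : MulAction (borel n) (UTilde n) where
  smul b p := ⟨b • p.1, by
    funext k
    have h := congrFun p.2 k
    change piV (b • p.1.1) k = projAd (Ad b p.1.2) k
    rw [piV_smul, projAd_Ad b p.1.2.2, h]⟩
  one_smul p := Subtype.ext (one_smul _ p.1)
  mul_smul b c p := Subtype.ext (mul_smul b c p.1)

/-- `M̃ = G ×^B 𝔲̃`. -/
abbrev MTilde (n : ℕ) := Mixed (borel n) (UTilde n)

/-- `η̃ : M̃ → Ñ`, `[g, (v, y)] ↦ [g, y]`. It is the quotient of `M̃` by the center `Z` of `G`. -/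
def etaTilde (n : ℕ) : MTilde n → NTilde n :=
  Mixed.map le_rfl (fun p : UTilde n => p.1.2) fun _ _ => rfl

/-- `M̃_χ`: the points of `M̃` whose stabilizer in `Z` lies in the kernel of `χ`. Here `Z` acts by
restriction of the left action of `G`. -/
def MTildeChi {n : ℕ} (χ : Subgroup.center (SL n) →* ℂˣ) : Set (MTilde n) :=
  {m | ∀ z : Subgroup.center (SL n), (z : SL n) • m = m → z ∈ χ.ker}

/-- `Ñ_χ = M̃_χ / Z`, the image of `M̃_χ` under the quotient map `η̃`. -/
def NTildeChi {n : ℕ} (χ : Subgroup.center (SL n) →* ℂˣ) : Set (NTilde n) :=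
  etaTilde n '' MTildeChi χ

end ExtendedSpringer

end

/-!
The proof describes both sides by the entries `x_{k,k+1}` of `x ∈ 𝔲` just above the diagonal. With
indices starting at `0`, call `x` *regular in the blocks* if `x_{k,k+1} ≠ 0` whenever `d ∤ k + 1`.

*The stratum `Ñ_χ`* (`mk_mem_NTildeChi_iff`). A central element `ζ · 1` fixes `[g, (v, x)]` if and
only if every character `s` in the cone with `v(s) ≠ 0` is trivial at it. If `s` is the class of the
vector `a`, then `s(ζ) = ζ ^ A` with `A = ∑ a i`, and the coefficient of the root with index `k`
in `s` is an integer minus `(k + 1) A / n` (`rootCoeff`, which is `n` times this coefficient). As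
`s ^ n` is a product of simple roots, `v(s) ≠ 0` means that all the roots in `s` are nonzero at `v`
(`val_coneWeight_ne_zero_iff`). So the roots that vanish at `v` impose `n ∣ (k + 1) A`, and
conversely every `A` with this property comes from some `s` (`exists_inRootCone_sum_eq`). Since the
center is cyclic of order `n`, the stabilizer lies in `ker χ` if and only if `d ∣ k + 1` for all the
vanishing roots. That every `x` occurs in some `[g, (v, x)]` is the surjectivity of `π`, which holds
because one may extract `n`-th roots (`piV_surjective`).

*The stratum `Ñ^P_reg`* (`mk_mem_NTildePReg`). The principal orbit consists of the block diagonal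
matrices whose blocks `N` are regular nilpotent, that is, nilpotent with `N ^ (d - 1) ≠ 0`: this
condition is open and `L`-stable, any two such matrices are `L`-conjugate because their blocks have
cyclic vectors, and they are dense because every nilpotent matrix can be made triangular
(`exists_regular_line`). For `x ∈ 𝔲` the diagonal blocks are regular nilpotent exactly when `x` is
regular in the blocks (`blockRegular_iff_projAd`). This gives the equality of the two subsets.

*The isomorphism* (`mapsIsomorphicallyOnto_rhoP`). The map `ρ_P` is injective over the stratum since
a regular nilpotent matrix stabilizes only one full flag (`mem_borel_of_mul_eq`). Locally its
inverse lifts to `G × (𝒩_L + 𝔲_P) → G × 𝔲`: near a given point one may choose in each block a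
standard basis vector `v` that is cyclic for all the diagonal blocks `N` in question, and the matrix with
columns `N ^ (d - 1) v, …, N v, v`, suitably normalized, conjugates into `𝔲` and depends regularly
on the point (`cyclicConjugator`). Such local lifts suffice for an isomorphism of the quotients
(`mapsIsomorphicallyOnto_of_local_lifts`).
-/

noncomputable section

namespace ExtendedSpringer

/-! ### Regular functions and morphisms -/

namespace SpaceWithFunctions

section Zariski

variable {X Y σ τ : Type*} {c : X → σ → ℂ} {c' : Y → τ → ℂ}

lemma isOpen_zariski_nonvanishing (q : MvPolynomial σ ℂ) :
    IsOpen[(zariski c).top] {x | MvPolynomial.eval (c x) q ≠ 0} :=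
  TopologicalSpace.isOpen_generateFrom_of_mem ⟨q, rfl⟩

/-- The nonvanishing sets of polynomials form a basis of the Zariski topology. -/
lemma isOpen_zariski_iff {U : Set X} : IsOpen[(zariski c).top] U ↔
    ∀ x ∈ U, ∃ q : MvPolynomial σ ℂ, MvPolynomial.eval (c x) q ≠ 0 ∧
      ∀ y, MvPolynomial.eval (c y) q ≠ 0 → y ∈ U := by
  constructor
  · intro h
    change TopologicalSpace.GenerateOpen _ U at h
    induction h with
    | basic s hs =>
      obtain ⟨q, rfl⟩ := hs
      exact fun x hx => ⟨q, hx, fun y hy => hy⟩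
    | univ => exact fun x _ => ⟨1, by simp, fun _ _ => trivial⟩
    | inter s t _ _ hs ht =>
      intro x hx
      obtain ⟨p, hp, hp'⟩ := hs x hx.1
      obtain ⟨q, hq, hq'⟩ := ht x hx.2
      refine ⟨p * q, by simp [hp, hq], fun y hy => ?_⟩
      rw [map_mul] at hy
      exact ⟨hp' y (left_ne_zero_of_mul hy), hq' y (right_ne_zero_of_mul hy)⟩
    | sUnion S _ hS =>
      rintro x ⟨s, hs, hx⟩
      obtain ⟨q, hq, hq'⟩ := hS s hs x hx
      exact ⟨q, hq, fun y hy => ⟨s, hs, hq' y hy⟩⟩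
  · intro h
    rw [@isOpen_iff_forall_mem_open _ (zariski c).top]
    intro x hx
    obtain ⟨q, hq, hq'⟩ := h x hx
    exact ⟨_, hq', isOpen_zariski_nonvanishing q, hq⟩

/-- The algebra of functions on `X` that are regular on `U`. -/
def regular (c : X → σ → ℂ) (U : Set X) : Subalgebra ℂ (X → ℂ) where
  carrier := {f | (zariski c).IsRegularOn U f}
  mul_mem' := by
    intro f g hf hg x hx
    obtain ⟨p, q, hq, h⟩ := hf x hx
    obtain ⟨p', q', hq', h'⟩ := hg x hx
    refine ⟨p * p', q * q', by simp [hq, hq'], fun y hy hne => ?_⟩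
    rw [map_mul] at hne
    rw [Pi.mul_apply, h y hy (left_ne_zero_of_mul hne), h' y hy (right_ne_zero_of_mul hne),
      map_mul, map_mul, div_mul_div_comm]
  add_mem' := by
    intro f g hf hg x hx
    obtain ⟨p, q, hq, h⟩ := hf x hx
    obtain ⟨p', q', hq', h'⟩ := hg x hx
    refine ⟨p * q' + q * p', q * q', by simp [hq, hq'], fun y hy hne => ?_⟩
    rw [map_mul] at hne
    rw [Pi.add_apply, h y hy (left_ne_zero_of_mul hne), h' y hy (right_ne_zero_of_mul hne),
      div_add_div _ _ (left_ne_zero_of_mul hne) (right_ne_zero_of_mul hne)]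
    simp only [map_mul, map_add]
  algebraMap_mem' := fun r x _ => ⟨MvPolynomial.C r, 1, by simp, fun y _ _ => by simp⟩

lemma mem_regular {U : Set X} {f : X → ℂ} : f ∈ regular c U ↔ (zariski c).IsRegularOn U f :=
  Iff.rfl

lemma coord_mem_regular (U : Set X) (i : σ) : (fun x => c x i) ∈ regular c U :=
  fun x _ => ⟨MvPolynomial.X i, 1, by simp, fun y _ _ => by simp⟩

lemma regular_congr {U : Set X} {f g : X → ℂ} (hf : f ∈ regular c U) (h : ∀ x ∈ U, g x = f x) :
    g ∈ regular c U := by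
  intro x hx
  obtain ⟨p, q, hq, h'⟩ := hf x hx
  exact ⟨p, q, hq, fun y hy hne => (h y hy).trans (h' y hy hne)⟩

lemma inv_mem_regular {U : Set X} {f : X → ℂ} (hf : f ∈ regular c U) (h : ∀ x ∈ U, f x ≠ 0) :
    (fun x => (f x)⁻¹) ∈ regular c U := by
  intro x hx
  obtain ⟨p, q, hq, h'⟩ := hf x hx
  have hp : MvPolynomial.eval (c x) p ≠ 0 := fun h0 => h x hx (by rw [h' x hx hq, h0, zero_div])
  refine ⟨q * q, p * q, by simp [hp, hq], fun y hy hne => ?_⟩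
  rw [map_mul] at hne
  have hq' := right_ne_zero_of_mul hne
  change (f y)⁻¹ = _
  rw [h' y hy hq', inv_div, map_mul, map_mul, mul_div_mul_right _ _ hq']

lemma isOpen_nonvanishing {U : Set X} (hU : IsOpen[(zariski c).top] U) {f : X → ℂ}
    (hf : f ∈ regular c U) : IsOpen[(zariski c).top] {x | x ∈ U ∧ f x ≠ 0} := by
  rw [isOpen_zariski_iff] at hU ⊢
  rintro x ⟨hx, hfx⟩
  obtain ⟨r, hr, hr'⟩ := hU x hx
  obtain ⟨p, q, hq, h'⟩ := hf x hx
  have hp : MvPolynomial.eval (c x) p ≠ 0 := fun h0 => hfx (by rw [h' x hx hq, h0, zero_div])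
  refine ⟨r * p * q, by simp [hr, hp, hq], fun y hy => ?_⟩
  rw [map_mul, map_mul] at hy
  have hyU := hr' y (left_ne_zero_of_mul (left_ne_zero_of_mul hy))
  refine ⟨hyU, ?_⟩
  rw [h' y hyU (right_ne_zero_of_mul hy)]
  exact div_ne_zero (right_ne_zero_of_mul (left_ne_zero_of_mul hy)) (right_ne_zero_of_mul hy)

/-- Polynomials in regular functions are regular. -/
lemma eval_mem_regular {U : Set X} {s : X → Y}
    (hs : ∀ i, (fun x => c' (s x) i) ∈ regular c U) (p : MvPolynomial τ ℂ) :
    (fun x => MvPolynomial.eval (c' (s x)) p) ∈ regular c U := by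
  induction p using MvPolynomial.induction_on with
  | C a =>
    simp only [MvPolynomial.eval_C]
    exact (regular c U).algebraMap_mem a
  | add p q hp hq => simpa [Pi.add_def] using add_mem hp hq
  | mul_X p i hp => simpa [Pi.mul_def] using mul_mem hp (hs i)

/-- A map with regular coordinates is continuous. -/
lemma isOpen_inter_preimage {U : Set X} (hU : IsOpen[(zariski c).top] U) {s : X → Y}
    (hs : ∀ i, (fun x => c' (s x) i) ∈ regular c U) {V : Set Y}
    (hV : IsOpen[(zariski c').top] V) : IsOpen[(zariski c).top] (U ∩ s ⁻¹' V) := by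
  rw [@isOpen_iff_forall_mem_open _ (zariski c).top]
  rintro x ⟨hx, hxV⟩
  obtain ⟨q, hq, hq'⟩ := isOpen_zariski_iff.1 hV _ hxV
  exact ⟨_, fun y hy => ⟨hy.1, hq' _ hy.2⟩, isOpen_nonvanishing hU (eval_mem_regular hs q), hx, hq⟩

/-- Regular functions pull back to regular functions along a map with regular coordinates. -/
lemma comp_mem_regular {U : Set X} {s : X → Y}
    (hs : ∀ i, (fun x => c' (s x) i) ∈ regular c U) {V : Set Y} {f : Y → ℂ}
    (hf : f ∈ regular c' V) : f ∘ s ∈ regular c (U ∩ s ⁻¹' V) := by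
  rintro x ⟨hx, hxV⟩
  obtain ⟨p, q, hq, h⟩ := hf _ hxV
  obtain ⟨p₁, p₂, hp₂, hp⟩ := eval_mem_regular hs p x hx
  obtain ⟨q₁, q₂, hq₂, hq₀⟩ := eval_mem_regular hs q x hx
  have hq₁ : MvPolynomial.eval (c x) q₁ ≠ 0 := fun h0 => hq (by
    have := hq₀ x hx hq₂
    rwa [h0, zero_div] at this)
  refine ⟨p₁ * (q₂ * q₂), p₂ * (q₁ * q₂), by simp [*], fun y hy hne => ?_⟩
  simp only [map_mul] at hne ⊢
  have n1 := left_ne_zero_of_mul hne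
  have n2 := left_ne_zero_of_mul (right_ne_zero_of_mul hne)
  have n3 := right_ne_zero_of_mul (right_ne_zero_of_mul hne)
  have e1 : MvPolynomial.eval (c' (s y)) p = _ := hp y hy.1 n1
  have e2 : MvPolynomial.eval (c' (s y)) q = _ := hq₀ y hy.1 n3
  rw [Function.comp_apply, h _ hy.2 (by rw [e2]; exact div_ne_zero n2 n3), e1, e2]
  field_simp

/-- Regularity is a local property. -/
lemma mem_regular_of_local {U : Set X} {f : X → ℂ}
    (h : ∀ x ∈ U, ∃ W, IsOpen[(zariski c).top] W ∧ x ∈ W ∧ f ∈ regular c W) :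
    f ∈ regular c U := by
  intro x hx
  obtain ⟨W, hW, hxW, hf⟩ := h x hx
  obtain ⟨r, hr, hr'⟩ := isOpen_zariski_iff.1 hW x hxW
  obtain ⟨p, q, hq, h'⟩ := hf x hxW
  refine ⟨p * r, q * r, by simp [hq, hr], fun y _ hne => ?_⟩
  rw [map_mul] at hne
  have n2 := right_ne_zero_of_mul hne
  rw [h' y (hr' y n2) (left_ne_zero_of_mul hne), map_mul, map_mul, mul_div_mul_right _ _ n2]

/-- A map of quotient spaces that lifts to a map with polynomial coordinates is a morphism. -/
lemma isMorphism_quotient {A B : Type*} {πX : X → A} {πY : Y → B} {φ : A → B} {s : X → Y}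
    (hs : ∀ i, (fun x => c' (s x) i) ∈ regular c Set.univ) (h : ∀ x, φ (πX x) = πY (s x)) :
    IsMorphism ((zariski c).quotient πX) ((zariski c').quotient πY) φ := by
  intro V hV
  have e : πX ⁻¹' (φ ⁻¹' V) = Set.univ ∩ s ⁻¹' (πY ⁻¹' V) := by
    ext x; simp [h]
  constructor
  · change IsOpen[(zariski c).top] (πX ⁻¹' (φ ⁻¹' V))
    rw [e]
    exact isOpen_inter_preimage (@isOpen_univ _ (zariski c).top) hs hV
  · intro f hf
    change (f ∘ φ) ∘ πX ∈ regular c (πX ⁻¹' (φ ⁻¹' V))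
    rw [e, show (f ∘ φ) ∘ πX = (f ∘ πY) ∘ s from funext fun x => congrArg f (h x)]
    exact comp_mem_regular hs hf

end Zariski

/-- Morphisms restrict to subvarieties. -/
lemma IsMorphism.restrict {A B : Type*} {S : SpaceWithFunctions A} {T : SpaceWithFunctions B}
    {φ : A → B} (hφ : IsMorphism S T φ) {A₀ : Set A} {B₀ : Set B} (h : Set.MapsTo φ A₀ B₀) :
    IsMorphism (S.induced A₀) (T.induced B₀) h.restrict := by
  rintro _ ⟨W, hW, rfl⟩
  refine ⟨⟨φ ⁻¹' W, (hφ W hW).1, rfl⟩, fun f hf a ha => ?_⟩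
  obtain ⟨W', F, hW', haW', hF, hfF⟩ := hf (h.restrict φ A₀ B₀ a) ha
  exact ⟨φ ⁻¹' W', F ∘ φ, (hφ W' hW').1, haW', (hφ W' hW').2 F hF,
    fun y hy hyW => hfF _ hy hyW⟩

/-- A morphism of quotient spaces that maps `A₀` injectively to `B₀` and that has, locally on the
part of `Y` over `B₀`, a lift of its inverse with regular coordinates, maps `A₀` isomorphically
onto `B₀`. -/
theorem mapsIsomorphicallyOnto_of_local_lifts {X Y σ τ A B : Type*} {c : X → σ → ℂ}
    {c' : Y → τ → ℂ} {πX : X → A} {πY : Y → B} (hπY : Function.Surjective πY) {φ : A → B}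
    {A₀ : Set A} {B₀ : Set B}
    (hφ : IsMorphism ((zariski c).quotient πX) ((zariski c').quotient πY) φ)
    (hmaps : Set.MapsTo φ A₀ B₀) (hinj : Set.InjOn φ A₀)
    (hlift : ∀ y, πY y ∈ B₀ → ∃ (U : Set Y) (s : Y → X), IsOpen[(zariski c').top] U ∧ y ∈ U ∧
      (∀ i, (fun y => c (s y) i) ∈ regular c' U) ∧
      ∀ y ∈ U, πX (s y) ∈ A₀ ∧ φ (πX (s y)) = πY y) :
    MapsIsomorphicallyOnto ((zariski c).quotient πX) ((zariski c').quotient πY) φ A₀ B₀ := by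
  refine ⟨hmaps, hφ.restrict hmaps, ?_⟩
  have hbij : Function.Bijective (hmaps.restrict φ A₀ B₀) := by
    refine ⟨fun a a' h => Subtype.ext (hinj a.2 a'.2 (congrArg Subtype.val h)), fun b => ?_⟩
    obtain ⟨y, hy⟩ := hπY b
    obtain ⟨U, s, -, hyU, -, hs⟩ := hlift y (hy ▸ b.2)
    exact ⟨⟨_, (hs y hyU).1⟩, Subtype.ext ((hs y hyU).2.trans hy)⟩
  set e := Equiv.ofBijective _ hbij with he
  refine ⟨e.symm, e.left_inv, e.right_inv, ?_⟩
  -- the inverse is computed by the local lifts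
  have key : ∀ y ∈ πY ⁻¹' B₀, ∃ (U : Set Y) (s : Y → X), IsOpen[(zariski c').top] U ∧ y ∈ U ∧
      (∀ i, (fun y => c (s y) i) ∈ regular c' U) ∧
      ∀ y ∈ U, ∃ h : πY y ∈ B₀, (e.symm ⟨πY y, h⟩ : A) = πX (s y) := by
    intro y hy
    obtain ⟨U, s, hU, hyU, hs, hs'⟩ := hlift y hy
    refine ⟨U, s, hU, hyU, hs, fun z hz => ?_⟩
    have hzB : πY z ∈ B₀ := (hs' z hz).2 ▸ hmaps (hs' z hz).1
    refine ⟨hzB, ?_⟩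
    have : e ⟨πX (s z), (hs' z hz).1⟩ = ⟨πY z, hzB⟩ := Subtype.ext (hs' z hz).2
    rw [← this, Equiv.symm_apply_apply]
  have hopen : ∀ W : Set A, IsOpen[((zariski c).quotient πX).top] W →
      IsOpen[((zariski c').quotient πY).top] {b | ∃ h : b ∈ B₀, (e.symm ⟨b, h⟩ : A) ∈ W} := by
    intro W hW
    change IsOpen[(zariski c').top] (πY ⁻¹' {b | ∃ h : b ∈ B₀, (e.symm ⟨b, h⟩ : A) ∈ W})
    rw [@isOpen_iff_forall_mem_open _ (zariski c').top]
    rintro y ⟨hy, hyW⟩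
    obtain ⟨U, s, hU, hyU, hs, hs'⟩ := key y hy
    refine ⟨U ∩ s ⁻¹' (πX ⁻¹' W), fun z hz => ?_, isOpen_inter_preimage hU hs hW, hyU, ?_⟩
    · obtain ⟨h1, h2⟩ := hs' z hz.1
      exact ⟨h1, h2 ▸ hz.2⟩
    · obtain ⟨h1, h2⟩ := hs' y hyU
      change πX (s y) ∈ W
      rw [← h2]; exact hyW
  rintro _ ⟨W, hW, rfl⟩
  refine ⟨⟨_, hopen W hW, ?_⟩, fun f hf b hb => ?_⟩
  · ext b
    exact ⟨fun ⟨_, h⟩ => h, fun h => ⟨b.2, h⟩⟩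
  · obtain ⟨W', F, hW', hbW', hF, hfF⟩ := hf (e.symm b) hb
    classical
    refine ⟨{b | ∃ h : b ∈ B₀, (e.symm ⟨b, h⟩ : A) ∈ W'},
      fun b => if h : b ∈ B₀ then F (e.symm ⟨b, h⟩) else 0, hopen W' hW', ⟨b.2, hbW'⟩, ?_, ?_⟩
    · refine mem_regular_of_local ?_
      rintro y ⟨hy, hyW⟩
      obtain ⟨U, s, hU, hyU, hs, hs'⟩ := key y hy
      refine ⟨U ∩ s ⁻¹' (πX ⁻¹' W'), isOpen_inter_preimage hU hs hW', ⟨hyU, ?_⟩, ?_⟩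
      · obtain ⟨h1, h2⟩ := hs' y hyU
        change πX (s y) ∈ W'
        rw [← h2]; exact hyW
      · refine regular_congr (comp_mem_regular hs (mem_regular.2 hF)) fun z hz => ?_
        obtain ⟨h1, h2⟩ := hs' z hz.1
        simp only [Function.comp_apply, dif_pos h1, h2]
    · rintro z hz ⟨h, hzW⟩
      simp only [Function.comp_apply, dif_pos z.2]
      exact hfF _ hz hzW

end SpaceWithFunctions

/-! ### Nilpotent `d × d` matrices -/

/-- A strictly upper triangular square matrix. -/
def IsStrictUpper {d : ℕ} (T : Matrix (Fin d) (Fin d) ℂ) : Prop := ∀ i j, j ≤ i → T i j = 0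

/-- The nilpotent Jordan block. -/
def jordan (d : ℕ) : Matrix (Fin d) (Fin d) ℂ :=
  Matrix.of fun i j => if (i : ℕ) + 1 = j then 1 else 0

lemma jordan_isStrictUpper (d : ℕ) : IsStrictUpper (jordan d) := by
  intro i j h
  have : ¬ (i : ℕ) + 1 = j := by have : (j : ℕ) ≤ i := h; omega
  simp [jordan, this]

lemma pow_eq_zero_of_isNilpotent {d : ℕ} {N : Matrix (Fin d) (Fin d) ℂ} (h : IsNilpotent N) :
    N ^ d = 0 := by
  have hc := (Matrix.isNilpotent_charpoly_sub_pow_of_isNilpotent h).eq_zero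
  have := Matrix.aeval_self_charpoly N
  rw [sub_eq_zero.1 hc] at this
  simpa using this

lemma IsStrictUpper.isNilpotent {d : ℕ} {T : Matrix (Fin d) (Fin d) ℂ} (h : IsStrictUpper T) :
    IsNilpotent T := by
  have hc := Matrix.charpoly_of_isUpperTriangular (M := T) (fun i j hij => h i j (le_of_lt hij))
  have := Matrix.aeval_self_charpoly T
  rw [hc] at this
  exact ⟨d, by simpa [h _ _ le_rfl] using this⟩

/-- The powers of a strictly upper triangular matrix `T`: the `m`-th power starts at the `m`-th
superdiagonal, where its entries are products of superdiagonal entries of `T`. -/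
lemma IsStrictUpper.pow_apply {d : ℕ} {T : Matrix (Fin d) (Fin d) ℂ} (h : IsStrictUpper T)
    {t : ℕ → ℂ} (ht : ∀ i j : Fin d, (i : ℕ) + 1 = j → T i j = t i) (m : ℕ) (i j : Fin d) :
    ((j : ℕ) < i + m → (T ^ m) i j = 0) ∧
      ((j : ℕ) = i + m → (T ^ m) i j = ∏ l ∈ Finset.range m, t (i + l)) := by
  induction m generalizing j with
  | zero =>
    refine ⟨fun hj => ?_, fun hj => ?_⟩
    · rw [pow_zero, Matrix.one_apply_ne]
      rintro rfl; omega
    · obtain rfl : j = i := Fin.ext (by omega)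
      simp
  | succ m ih =>
    rw [pow_succ, Matrix.mul_apply]
    refine ⟨fun hj => Finset.sum_eq_zero fun k _ => ?_, fun hj => ?_⟩
    · by_cases hk : (k : ℕ) < i + m
      · rw [(ih k).1 hk, zero_mul]
      · rw [h k j (Fin.le_def.2 (by omega)), mul_zero]
    · have hlt : (i : ℕ) + m < d := by have := j.2; omega
      rw [Finset.sum_eq_single ⟨i + m, hlt⟩, (ih _).2 rfl, ht _ _ (by simp; omega),
        Finset.prod_range_succ]
      · intro k _ hk
        have hk' : (k : ℕ) ≠ i + m := fun e => hk (Fin.ext e)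
        by_cases hk : (k : ℕ) < i + m
        · rw [(ih k).1 hk, zero_mul]
        · rw [h k j (Fin.le_def.2 (by omega)), mul_zero]
      · exact fun hk => absurd (Finset.mem_univ _) hk

/-- A strictly upper triangular matrix is regular nilpotent if and only if all the entries just
above its diagonal are nonzero. -/
lemma IsStrictUpper.pow_ne_zero_iff {d : ℕ} {T : Matrix (Fin d) (Fin d) ℂ} (h : IsStrictUpper T)
    (hd : 0 < d) : T ^ (d - 1) ≠ 0 ↔ ∀ i j : Fin d, (i : ℕ) + 1 = j → T i j ≠ 0 := by
  set t : ℕ → ℂ := fun i => if h : i + 1 < d then T ⟨i, by omega⟩ ⟨i + 1, h⟩ else 0 with ht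
  have ht' : ∀ i j : Fin d, (i : ℕ) + 1 = j → T i j = t i := by
    intro i j hij
    have : (i : ℕ) + 1 < d := hij ▸ j.2
    obtain rfl : j = ⟨i + 1, this⟩ := Fin.ext hij.symm
    simp [ht, this]
  have hprod : (T ^ (d - 1)) ⟨0, hd⟩ ⟨d - 1, by omega⟩ = ∏ l ∈ Finset.range (d - 1), t l := by
    rw [(h.pow_apply ht' (d - 1) _ _).2 (by simp)]
    simp
  constructor
  · intro hne i j hij h0
    refine hne ?_
    ext a b
    rw [Matrix.zero_apply]
    by_cases hab : (b : ℕ) < a + (d - 1)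
    · exact (h.pow_apply ht' _ _ _).1 hab
    · have h1 := a.2
      have h2 := b.2
      rw [show a = ⟨0, hd⟩ from Fin.ext (by simp; omega),
        show b = ⟨d - 1, Nat.sub_lt hd one_pos⟩ from Fin.ext (by simp; omega), hprod]
      have := j.2
      exact Finset.prod_eq_zero (i := (i : ℕ)) (Finset.mem_range.2 (by omega)) (by
        rw [← ht' i j hij, h0])
  · intro hne h0
    rw [h0, Matrix.zero_apply, eq_comm, Finset.prod_eq_zero_iff] at hprod
    obtain ⟨l, hl, hl0⟩ := hprod
    have hl' := Finset.mem_range.1 hl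
    refine hne ⟨l, by omega⟩ ⟨l + 1, by omega⟩ rfl ?_
    rw [ht' _ _ rfl]
    exact hl0

lemma jordan_pow_ne_zero {d : ℕ} (hd : 0 < d) : jordan d ^ (d - 1) ≠ 0 := by
  rw [(jordan_isStrictUpper d).pow_ne_zero_iff hd]
  intro i j h
  simp [jordan, h]

/-- The matrix with columns `N ^ (d - 1) v, …, N v, v`, where `v` is the standard basis vector
with index `j`. -/
def cyclicMatrix {d : ℕ} (N : Matrix (Fin d) (Fin d) ℂ) (j : Fin d) : Matrix (Fin d) (Fin d) ℂ :=
  Matrix.of fun r c => (N ^ (d - 1 - (c : ℕ))) r j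

lemma mul_cyclicMatrix {d : ℕ} {N : Matrix (Fin d) (Fin d) ℂ} (hN : N ^ d = 0) (j : Fin d) :
    N * cyclicMatrix N j = cyclicMatrix N j * jordan d := by
  have hmul : ∀ r c, (N * cyclicMatrix N j) r c = (N ^ (d - 1 - (c : ℕ) + 1)) r j := by
    intro r c
    rw [pow_succ', Matrix.mul_apply, Matrix.mul_apply]
    rfl
  ext r c
  rw [hmul, Matrix.mul_apply]
  have hc := c.2
  by_cases h0 : (c : ℕ) = 0
  · rw [Finset.sum_eq_zero]
    · rw [show d - 1 - (c : ℕ) + 1 = d by omega, hN, Matrix.zero_apply]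
    · intro k _
      simp [jordan, h0]
  · rw [Finset.sum_eq_single ⟨c - 1, by omega⟩]
    · rw [jordan, cyclicMatrix, Matrix.of_apply, Matrix.of_apply,
        if_pos (show (c : ℕ) - 1 + 1 = c by omega), mul_one,
        show d - 1 - (c : ℕ) + 1 = d - 1 - ((c : ℕ) - 1) by omega]
    · intro k _ hk
      have : ¬ (k : ℕ) + 1 = c := fun e => hk (Fin.ext (by simp; omega))
      simp [jordan, this]
    · exact fun hk => absurd (Finset.mem_univ _) hk

/-- If `N ^ d = 0` and `N ^ (d - 1) v ≠ 0`, then `v` is a cyclic vector for `N`. -/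
lemma det_cyclicMatrix_ne_zero {d : ℕ} {N : Matrix (Fin d) (Fin d) ℂ} (hN : N ^ d = 0)
    {j r : Fin d} (hj : (N ^ (d - 1)) r j ≠ 0) : (cyclicMatrix N j).det ≠ 0 := by
  intro hdet
  obtain ⟨w, hw, hw0⟩ := Matrix.exists_mulVec_eq_zero_iff.2 hdet
  refine hw ?_
  -- the coefficients of a relation vanish one by one, starting with that of `v`
  have key : ∀ m : ℕ, ∀ c : Fin d, d ≤ (c : ℕ) + 1 + m → w c = 0 := by
    intro m
    induction m using Nat.strong_induction_on with
    | _ m ih =>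
      intro c hc
      by_cases hlt : d ≤ (c : ℕ) + m
      · have hcd := c.2
        exact ih (m - 1) (by omega) c (by omega)
      have hcm : (c : ℕ) + 1 + m = d := by omega
      -- apply `N ^ (d - 1 - m)` to the relation
      have h1 : ((N ^ (c : ℕ)) * cyclicMatrix N j).mulVec w r = 0 := by
        rw [← Matrix.mulVec_mulVec, hw0, Matrix.mulVec_zero, Pi.zero_apply]
      have h2 : ∀ c', ((N ^ (c : ℕ)) * cyclicMatrix N j) r c' =
          (N ^ ((c : ℕ) + (d - 1 - (c' : ℕ)))) r j := by
        intro c'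
        rw [pow_add, Matrix.mul_apply, Matrix.mul_apply]
        rfl
      rw [Matrix.mulVec, dotProduct, Finset.sum_eq_single c] at h1
      · rw [h2, show (c : ℕ) + (d - 1 - (c : ℕ)) = d - 1 by omega] at h1
        exact (mul_eq_zero.1 h1).resolve_left hj
      · intro c' _ hc'
        rcases lt_or_gt_of_ne hc' with h | h
        · have h' : (c' : ℕ) < c := h
          rw [h2, show (c : ℕ) + (d - 1 - (c' : ℕ)) = d + ((c : ℕ) - 1 - c') by omega, pow_add, hN,
            zero_mul, Matrix.zero_apply, zero_mul]
        · have h' : (c : ℕ) < c' := h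
          have := c'.2
          rw [ih (m - 1) (by omega) c' (by omega), mul_zero]
      · exact fun hk => absurd (Finset.mem_univ _) hk
  funext c
  exact key d c (by omega)

/-- A regular nilpotent matrix is conjugate to the Jordan block. -/
lemma exists_conj_jordan {d : ℕ} {N : Matrix (Fin d) (Fin d) ℂ} (hN : IsNilpotent N)
    (hreg : N ^ (d - 1) ≠ 0) :
    ∃ g : Matrix (Fin d) (Fin d) ℂ, g.det ≠ 0 ∧ N * g = g * jordan d := by
  obtain ⟨r, j, h⟩ : ∃ r j, (N ^ (d - 1)) r j ≠ 0 := by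
    by_contra! h
    exact hreg (Matrix.ext h)
  have hd := pow_eq_zero_of_isNilpotent hN
  exact ⟨_, det_cyclicMatrix_ne_zero hd h, mul_cyclicMatrix hd j⟩

/-- A nilpotent endomorphism is strictly triangular on a linearly independent family of any
possible length `m`. Given such a family with span `W ≠ V`, the next vector is the last one outside
`W` among the `f ^ k v`, for any `v ∉ W`. -/
lemma exists_triangular_family {V : Type*} [AddCommGroup V] [Module ℂ V] [FiniteDimensional ℂ V]
    {f : V →ₗ[ℂ] V} (hf : IsNilpotent f) (m : ℕ) (hm : m ≤ Module.finrank ℂ V) :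
    ∃ b : Fin m → V, LinearIndependent ℂ b ∧ ∀ j, f (b j) ∈ Submodule.span ℂ (b '' Set.Iio j) := by
  induction m with
  | zero => exact ⟨Fin.elim0, linearIndependent_empty_type, fun j => j.elim0⟩
  | succ m ih =>
    obtain ⟨b, hb, hbf⟩ := ih (by omega)
    set W := Submodule.span ℂ (Set.range b) with hW
    have hWtop : ∃ v, v ∉ W := by
      by_contra! h
      have h1 := finrank_range_le_card (R := ℂ) b
      have h2 : W = ⊤ := Submodule.eq_top_iff'.2 h
      rw [Set.finrank, ← hW, h2, finrank_top, Fintype.card_fin] at h1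
      omega
    obtain ⟨v, hv⟩ := hWtop
    obtain ⟨k, hk⟩ := hf
    have hex : ∃ k, (f ^ k) v ∈ W := ⟨k, by rw [hk]; exact W.zero_mem⟩
    classical
    have h1 := Nat.find_spec hex
    have h0 : Nat.find hex ≠ 0 := by
      intro h0
      rw [h0] at h1
      exact hv h1
    obtain ⟨l, hl⟩ := Nat.exists_eq_succ_of_ne_zero h0
    have h2 := Nat.find_min hex (m := l) (by omega)
    rw [hl, pow_succ'] at h1
    refine ⟨Fin.snoc (α := fun _ => V) b ((f ^ l) v), linearIndependent_finSnoc.2 ⟨hb, h2⟩, ?_⟩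
    intro j
    refine Fin.lastCases ?_ (fun j => ?_) j
    · rw [Fin.snoc_last]
      refine Submodule.span_mono ?_ h1
      rintro _ ⟨i, rfl⟩
      exact ⟨i.castSucc, Fin.castSucc_lt_last i, by simp⟩
    · rw [Fin.snoc_castSucc]
      refine Submodule.span_mono ?_ (hbf j)
      rintro _ ⟨i, hi, rfl⟩
      exact ⟨i.castSucc, Fin.castSucc_lt_castSucc_iff.2 hi, by simp⟩

/-- A nilpotent matrix is conjugate to a strictly upper triangular one. -/
lemma exists_conj_strictUpper {d : ℕ} {N : Matrix (Fin d) (Fin d) ℂ} (hN : IsNilpotent N) :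
    ∃ g T : Matrix (Fin d) (Fin d) ℂ, g.det ≠ 0 ∧ IsStrictUpper T ∧ N * g = g * T := by
  have hf : IsNilpotent (Matrix.toLin' N) := by
    obtain ⟨k, hk⟩ := hN
    exact ⟨k, by rw [← Matrix.toLin'_pow, hk, map_zero]⟩
  obtain ⟨b, hb, hbf⟩ := exists_triangular_family hf d (by simp)
  have h : ∀ j, ∃ t : Fin d → ℂ, (∀ i, j ≤ i → t i = 0) ∧ N.mulVec (b j) = ∑ i, t i • b i := by
    intro j
    let B := basisOfLinearIndependentOfCardEqFinrank' b hb (by simp)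
    have hB : ⇑B = b := coe_basisOfLinearIndependentOfCardEqFinrank' b hb (by simp)
    have h1 := hbf j
    rw [← hB, Module.Basis.mem_span_image, hB] at h1
    refine ⟨B.repr (N.mulVec (b j)), fun i hi => ?_, ?_⟩
    · by_contra hne
      exact absurd (h1 (Finsupp.mem_support_iff.2 hne)) (not_lt.2 hi)
    · conv_lhs => rw [← B.sum_repr (N.mulVec (b j)), hB]
  choose t ht ht' using h
  refine ⟨Matrix.of fun i j => b j i, Matrix.of fun i j => t j i, ?_, fun i j hij => ht j i hij, ?_⟩
  · have : LinearIndependent ℂ (Matrix.of fun i j => b j i).col := hb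
    have hunit := Matrix.linearIndependent_cols_iff_isUnit.1 this
    exact ((Matrix.isUnit_iff_isUnit_det _).1 hunit).ne_zero
  · ext i j
    have := congrFun (ht' j) i
    simp only [Finset.sum_apply, Pi.smul_apply, smul_eq_mul] at this
    simp only [Matrix.mul_apply, Matrix.of_apply]
    rw [Matrix.mulVec, dotProduct] at this
    rw [this]
    exact Finset.sum_congr rfl fun k _ => mul_comm _ _

/-- The regular nilpotent matrices are dense in the nilpotent matrices: through a nilpotent matrix
`N` there is a line `N + ε W` whose points for small `ε ≠ 0` are regular nilpotent. -/
lemma exists_regular_line {d : ℕ} (hd : 0 < d) {N : Matrix (Fin d) (Fin d) ℂ}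
    (hN : IsNilpotent N) : ∃ W : Matrix (Fin d) (Fin d) ℂ, ∀ᶠ ε : ℂ in 𝓝[≠] 0,
      IsNilpotent (N + ε • W) ∧ (N + ε • W) ^ (d - 1) ≠ 0 := by
  obtain ⟨g, T, hg, hT, hgT⟩ := exists_conj_strictUpper hN
  have hu : IsUnit g.det := hg.isUnit
  have h1 : g * g⁻¹ = 1 := Matrix.mul_nonsing_inv g hu
  have h2 : g⁻¹ * g = 1 := Matrix.nonsing_inv_mul g hu
  have hε : ∀ ε : ℂ, N + ε • (g * jordan d * g⁻¹) = g * (T + ε • jordan d) * g⁻¹ := by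
    intro ε
    rw [mul_add, add_mul, ← hgT, mul_assoc N, h1, mul_one, mul_smul_comm, smul_mul_assoc]
  have hpow : ∀ (A : Matrix (Fin d) (Fin d) ℂ) k, (g * A * g⁻¹) ^ k = g * A ^ k * g⁻¹ :=
    fun A k => Units.conj_pow (⟨g, g⁻¹, h1, h2⟩ : (Matrix (Fin d) (Fin d) ℂ)ˣ) A k
  refine ⟨g * jordan d * g⁻¹, ?_⟩
  have hentry : ∀ i j : Fin d, ∀ᶠ ε : ℂ in 𝓝[≠] 0,
      (i : ℕ) + 1 = j → (T + ε • jordan d) i j ≠ 0 := by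
    intro i j
    have hfin : ∀ᶠ ε : ℂ in 𝓝[≠] 0, ε ≠ - T i j := by
      by_cases h0 : - T i j = 0
      · rw [h0]; exact self_mem_nhdsWithin
      · exact Filter.Eventually.filter_mono nhdsWithin_le_nhds (eventually_ne_nhds (Ne.symm h0))
    filter_upwards [hfin] with ε hε hij h0
    simp [jordan, hij] at h0
    exact hε (by linear_combination h0)
  have hall := Filter.eventually_all.2 fun i => Filter.eventually_all.2 (hentry i)
  filter_upwards [hall] with ε h
  have hS : IsStrictUpper (T + ε • jordan d) := fun i j hij => by
    simp [hT i j hij, jordan_isStrictUpper d i j hij]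
  rw [hε]
  constructor
  · obtain ⟨k, hk⟩ := hS.isNilpotent
    exact ⟨k, by rw [hpow, hk, mul_zero, zero_mul]⟩
  · intro h0
    rw [hpow] at h0
    refine (hS.pow_ne_zero_iff hd).2 h ?_
    have := congrArg (fun A => g⁻¹ * A * g) h0
    simpa [mul_assoc, h2, ← mul_assoc g⁻¹ g] using this

/-! ### Block matrices -/

section Blocks

variable {q d : ℕ}

/-- The `i`-th index in the block with number `b`, for `q` blocks of size `d`. -/
def idx (b : Fin q) (i : Fin d) : Fin (q * d) := finProdFinEquiv (b, i)

lemma coe_idx (b : Fin q) (i : Fin d) : (idx b i : ℕ) = i + d * b := rfl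

lemma blk_idx (b : Fin q) (i : Fin d) : blk d (idx b i) = b := by
  rw [blk, coe_idx, Nat.add_mul_div_left _ _ i.pos, Nat.div_eq_of_lt i.2, zero_add]

lemma exists_idx (r : Fin (q * d)) : ∃ b i, r = idx b i :=
  ⟨(finProdFinEquiv.symm r).1, (finProdFinEquiv.symm r).2,
    (finProdFinEquiv.apply_symm_apply r).symm⟩

lemma idx_inj {b b' : Fin q} {i i' : Fin d} : idx b i = idx b' i' ↔ b = b' ∧ i = i' := by
  rw [idx, idx, finProdFinEquiv.injective.eq_iff, Prod.mk.injEq]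

lemma sum_idx (f : Fin (q * d) → ℂ) : ∑ r, f r = ∑ b, ∑ i, f (idx b i) := by
  rw [← finProdFinEquiv.sum_comp, Fintype.sum_prod_type]
  rfl

/-- The diagonal block of `x` with number `b`. -/
def diagBlock (x : Mat (q * d)) (b : Fin q) : Matrix (Fin d) (Fin d) ℂ :=
  x.submatrix (idx b) (idx b)

/-- The block diagonal matrix with diagonal blocks `M b`. -/
def blockDiag (M : Fin q → Matrix (Fin d) (Fin d) ℂ) : Mat (q * d) :=
  (Matrix.blockDiagonal M).submatrix
    ((Equiv.prodComm _ _).trans (finProdFinEquiv (m := q) (n := d))).symm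
    ((Equiv.prodComm _ _).trans (finProdFinEquiv (m := q) (n := d))).symm

lemma blockDiag_idx (M : Fin q → Matrix (Fin d) (Fin d) ℂ) (b b' : Fin q) (i i' : Fin d) :
    blockDiag M (idx b i) (idx b' i') = if b = b' then M b i i' else 0 := by
  simp [blockDiag, idx, Matrix.blockDiagonal_apply]

lemma diagBlock_apply (x : Mat (q * d)) (b : Fin q) (i j : Fin d) :
    diagBlock x b i j = x (idx b i) (idx b j) := rfl

lemma diagBlock_blockDiag (M : Fin q → Matrix (Fin d) (Fin d) ℂ) (b : Fin q) :
    diagBlock (blockDiag M) b = M b := by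
  ext i j
  rw [diagBlock_apply, blockDiag_idx, if_pos rfl]

lemma blockDiag_mul (M N : Fin q → Matrix (Fin d) (Fin d) ℂ) :
    blockDiag (fun b => M b * N b) = blockDiag M * blockDiag N := by
  rw [blockDiag, Matrix.blockDiagonal_mul, blockDiag, blockDiag, Matrix.submatrix_mul_equiv]

lemma blockDiag_pow (M : Fin q → Matrix (Fin d) (Fin d) ℂ) (k : ℕ) (hk : k ≠ 0) :
    blockDiag M ^ k = blockDiag (fun b => M b ^ k) := by
  induction k with
  | zero => exact absurd rfl hk
  | succ k ih =>
    by_cases h0 : k = 0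
    · subst h0; simp
    · simp only [pow_succ, blockDiag_mul, ih h0]

lemma det_blockDiag (M : Fin q → Matrix (Fin d) (Fin d) ℂ) :
    (blockDiag M).det = ∏ b, (M b).det := by
  rw [blockDiag, Matrix.det_submatrix_equiv_self, Matrix.det_blockDiagonal]

lemma blockDiag_eq_zero_of_ne (M : Fin q → Matrix (Fin d) (Fin d) ℂ) {r s : Fin (q * d)}
    (h : blk d r ≠ blk d s) : blockDiag M r s = 0 := by
  obtain ⟨b, i, rfl⟩ := exists_idx r
  obtain ⟨b', i', rfl⟩ := exists_idx s
  rw [blockDiag_idx, if_neg]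
  rintro rfl
  simp [blk_idx] at h

lemma blockDiag_blockTriangular (M : Fin q → Matrix (Fin d) (Fin d) ℂ) :
    (blockDiag M).BlockTriangular (blk d) :=
  fun _ _ h => blockDiag_eq_zero_of_ne M (ne_of_gt h)

lemma diagBlock_mul {x y : Mat (q * d)} (hx : x.BlockTriangular (blk d))
    (hy : y.BlockTriangular (blk d)) (b : Fin q) :
    diagBlock (x * y) b = diagBlock x b * diagBlock y b := by
  ext i j
  rw [diagBlock_apply, Matrix.mul_apply, Matrix.mul_apply, sum_idx, Finset.sum_eq_single b]
  · rfl
  · intro b' _ hb'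
    refine Finset.sum_eq_zero fun k _ => ?_
    rcases lt_or_gt_of_ne hb' with h | h
    · rw [hx (by rw [blk_idx, blk_idx]; exact h), zero_mul]
    · rw [hy (i := idx b' k) (by rw [blk_idx, blk_idx]; exact h), mul_zero]
  · exact fun hk => absurd (Finset.mem_univ _) hk

lemma diagBlock_one (b : Fin q) : diagBlock (1 : Mat (q * d)) b = 1 := by
  ext i j
  simp [diagBlock_apply, Matrix.one_apply, idx_inj]

lemma diagPart_eq (x : Mat (q * d)) : diagPart d x = blockDiag (diagBlock x) := by
  ext r s
  obtain ⟨b, i, rfl⟩ := exists_idx r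
  obtain ⟨b', i', rfl⟩ := exists_idx s
  rw [blockDiag_idx, diagPart, Matrix.of_apply, blk_idx, blk_idx]
  by_cases h : b = b'
  · subst h; simp [diagBlock_apply]
  · simp [h, Fin.val_inj]

lemma isNilpotent_blockDiag_iff (hd : 0 < d) (M : Fin q → Matrix (Fin d) (Fin d) ℂ) :
    IsNilpotent (blockDiag M) ↔ ∀ b, IsNilpotent (M b) := by
  constructor
  · rintro ⟨k, hk⟩ b
    refine ⟨k + 1, ?_⟩
    have h : blockDiag (fun b => M b ^ (k + 1)) = 0 := by
      rw [← blockDiag_pow M _ (by omega), pow_succ, hk, zero_mul]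
    rw [← diagBlock_blockDiag (fun b => M b ^ (k + 1)) b, h]
    rfl
  · intro h
    refine ⟨d, ?_⟩
    rw [blockDiag_pow M d hd.ne']
    ext r s
    obtain ⟨b, i, rfl⟩ := exists_idx r
    obtain ⟨b', i', rfl⟩ := exists_idx s
    simp [blockDiag_idx, pow_eq_zero_of_isNilpotent (h b)]

lemma mem_add_iff_diagBlock (hd : 0 < d) {x : Mat (q * d)} :
    x ∈ nilconeL (q * d) d + nilradicalP (q * d) d ↔
      x.BlockTriangular (blk d) ∧ ∀ b, IsNilpotent (diagBlock x b) := by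
  rw [mem_add_iff, diagPart_eq, isNilpotent_blockDiag_iff hd]

lemma eq_blockDiag_of_mem_nilconeL {y : Mat (q * d)} (hy : y ∈ nilconeL (q * d) d) :
    y = blockDiag (diagBlock y) := by
  rw [← diagPart_eq]
  ext r s
  by_cases h : blk d r = blk d s
  · simp [diagPart, h]
  · simp [diagPart, h, hy.1.1 r s h]

lemma blockDiag_mem_nilconeL (hd : 0 < d) {M : Fin q → Matrix (Fin d) (Fin d) ℂ}
    (h : ∀ b, IsNilpotent (M b)) : blockDiag M ∈ nilconeL (q * d) d := by
  have hn := (isNilpotent_blockDiag_iff hd M).2 h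
  exact ⟨⟨fun r s hrs => blockDiag_eq_zero_of_ne M hrs,
    (Matrix.isNilpotent_trace_of_isNilpotent hn).eq_zero⟩, hn⟩

lemma mem_levi_of_coe_eq_blockDiag {l : SL (q * d)} {M : Fin q → Matrix (Fin d) (Fin d) ℂ}
    (h : (l : Mat (q * d)) = blockDiag M) : l ∈ levi (q * d) d := by
  refine ⟨fun r s hrs => ?_, fun r s hrs => ?_⟩
  · rw [h]
    exact blockDiag_eq_zero_of_ne M (ne_of_gt hrs)
  · rw [h]
    exact blockDiag_eq_zero_of_ne M (ne_of_lt (OrderDual.toDual_lt_toDual.1 hrs))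

/-- The diagonal blocks of `x` are regular nilpotent (given that they are nilpotent). -/
def BlockRegular (x : Mat (q * d)) : Prop := ∀ b, diagBlock x b ^ (d - 1) ≠ 0

lemma diagBlock_Ad {g : SL (q * d)} (hg : g ∈ parabolic (q * d) d) {x : Mat (q * d)}
    (hx : x.BlockTriangular (blk d)) (b : Fin q) : diagBlock (Ad g x) b =
      diagBlock g b * diagBlock x b * diagBlock ((g⁻¹ : SL (q * d)) : Mat (q * d)) b := by
  have hg' : (g : Mat (q * d)).BlockTriangular (blk d) := hg
  have hi : ((g⁻¹ : SL (q * d)) : Mat (q * d)).BlockTriangular (blk d) := inv_mem hg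
  rw [Ad, diagBlock_mul (hg'.mul hx) hi, diagBlock_mul hg' hx]

lemma diagBlock_Ad_pow {g : SL (q * d)} (hg : g ∈ parabolic (q * d) d) {x : Mat (q * d)}
    (hx : x.BlockTriangular (blk d)) (b : Fin q) (k : ℕ) : diagBlock (Ad g x) b ^ k =
      diagBlock g b * diagBlock x b ^ k * diagBlock ((g⁻¹ : SL (q * d)) : Mat (q * d)) b := by
  have hg' : (g : Mat (q * d)).BlockTriangular (blk d) := hg
  have hi : ((g⁻¹ : SL (q * d)) : Mat (q * d)).BlockTriangular (blk d) := inv_mem hg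
  have h1 : diagBlock (g : Mat (q * d)) b * diagBlock ((g⁻¹ : SL (q * d)) : Mat (q * d)) b = 1 := by
    rw [← diagBlock_mul hg' hi, coe_mul_inv, diagBlock_one]
  have h2 : diagBlock ((g⁻¹ : SL (q * d)) : Mat (q * d)) b * diagBlock (g : Mat (q * d)) b = 1 := by
    rw [← diagBlock_mul hi hg', coe_inv_mul, diagBlock_one]
  rw [diagBlock_Ad hg hx]
  exact Units.conj_pow (⟨_, _, h1, h2⟩ : (Matrix (Fin d) (Fin d) ℂ)ˣ) (diagBlock x b) k

lemma Ad_blockTriangular {g : SL (q * d)} (hg : g ∈ parabolic (q * d) d) {x : Mat (q * d)}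
    (hx : x.BlockTriangular (blk d)) : (Ad g x).BlockTriangular (blk d) := by
  have hg' : (g : Mat (q * d)).BlockTriangular (blk d) := hg
  have hi : ((g⁻¹ : SL (q * d)) : Mat (q * d)).BlockTriangular (blk d) := inv_mem hg
  exact (hg'.mul hx).mul hi

lemma BlockRegular.conj {g : SL (q * d)} (hg : g ∈ parabolic (q * d) d) {x : Mat (q * d)}
    (hx : x.BlockTriangular (blk d)) (h : BlockRegular x) : BlockRegular (Ad g x) := by
  intro b h0
  refine h b ?_
  have e : Ad g⁻¹ (Ad g x) = x := by rw [← Ad_mul, inv_mul_cancel, Ad_one]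
  rw [← e, diagBlock_Ad_pow (inv_mem hg) (Ad_blockTriangular hg hx), h0, mul_zero, zero_mul]

lemma Ad_eq_of_mul_eq {n : ℕ} {g : SL n} {x y : Mat n}
    (h : (g : Mat n) * x = y * (g : Mat n)) : Ad g x = y := by
  rw [Ad, h, mul_assoc, coe_mul_inv, mul_one]

/-- For `x ∈ 𝔲`, the diagonal blocks are regular nilpotent if and only if all the entries of `x`
just above the diagonal and inside the blocks are nonzero. -/
lemma blockRegular_iff_projAd (hd : 0 < d) {x : Mat (q * d)} (hx : x ∈ nilradical (q * d)) :
    BlockRegular x ↔ ∀ k : Fin (q * d - 1), ¬ d ∣ (k : ℕ) + 1 → projAd x k ≠ 0 := by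
  have hS : ∀ b, IsStrictUpper (diagBlock x b) := fun b i j hij =>
    hx _ _ (by rw [Fin.le_def, coe_idx, coe_idx]; have : (j : ℕ) ≤ i := hij; omega)
  have h1 : BlockRegular x ↔ ∀ (b : Fin q) (i j : Fin d), (i : ℕ) + 1 = j →
      x (idx b i) (idx b j) ≠ 0 :=
    forall_congr' fun b => (hS b).pow_ne_zero_iff hd
  rw [h1]
  constructor
  · intro h k hk
    have hk' := k.2
    obtain ⟨b, i, hbi⟩ := exists_idx (q := q) (d := d) ⟨k, by omega⟩
    have e : (k : ℕ) = i + d * b := congrArg Fin.val hbi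
    have hi : (i : ℕ) + 1 < d := by
      by_contra hcon
      have hid := i.2
      refine hk ⟨b + 1, ?_⟩
      rw [e, mul_add]
      omega
    have := h b i ⟨i + 1, hi⟩ rfl
    rw [← hbi] at this
    have e2 : idx b (⟨i + 1, hi⟩ : Fin d) = ⟨k + 1, by omega⟩ := Fin.ext (by
      simp only [coe_idx]; omega)
    rwa [e2] at this
  · intro h b i j hij
    have hlt : (idx b i : ℕ) + 1 < q * d := by
      have := (idx b j).2
      rw [coe_idx] at this ⊢
      omega
    have := h ⟨idx b i, by omega⟩ (by
      rw [coe_idx]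
      intro hdiv
      have h2 : d ∣ (i : ℕ) + 1 := (Nat.dvd_add_left (dvd_mul_right d (b : ℕ))).1
        (by rwa [add_right_comm] at hdiv)
      have := Nat.le_of_dvd (by omega) h2
      have := j.2
      omega)
    have e2 : idx b j = ⟨idx b i + 1, hlt⟩ := Fin.ext (by
      simp only [coe_idx]; omega)
    rw [e2]
    exact this

end Blocks

/-! ### Matrices of regular functions -/

/-- The entries of the matrix valued function `A` lie in `R`. -/
def EntriesIn {X m n : Type*} (R : Subalgebra ℂ (X → ℂ)) (A : X → Matrix m n ℂ) : Prop :=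
  ∀ i j, (fun x => A x i j) ∈ R

namespace EntriesIn

variable {X l m n : Type*} {R : Subalgebra ℂ (X → ℂ)}

lemma mul [Fintype m] {A : X → Matrix l m ℂ} {B : X → Matrix m n ℂ} (hA : EntriesIn R A)
    (hB : EntriesIn R B) : EntriesIn R fun x => A x * B x := by
  intro i j
  have : (fun x => (A x * B x) i j) = ∑ k, (fun x => A x i k) * fun x => B x k j := by
    funext x
    simp [Matrix.mul_apply]
  rw [this]
  exact sum_mem fun k _ => mul_mem (hA i k) (hB k j)

lemma const (A : Matrix m n ℂ) : EntriesIn R fun _ : X => A :=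
  fun i j => R.algebraMap_mem (A i j)

lemma pow [Fintype m] [DecidableEq m] {A : X → Matrix m m ℂ} (hA : EntriesIn R A) (k : ℕ) :
    EntriesIn R fun x => A x ^ k := by
  induction k with
  | zero => simpa only [pow_zero] using const 1
  | succ k ih => simpa only [pow_succ] using ih.mul hA

lemma det [Fintype m] [DecidableEq m] {A : X → Matrix m m ℂ} (hA : EntriesIn R A) :
    (fun x => (A x).det) ∈ R := by
  have : (fun x => (A x).det) = ∑ σ : Equiv.Perm m,
      (fun _ => ((Equiv.Perm.sign σ : ℤ) : ℂ)) * ∏ i, fun x => A x (σ i) i := by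
    funext x
    simp [Matrix.det_apply']
  rw [this]
  exact sum_mem fun σ _ => mul_mem (R.algebraMap_mem _) (prod_mem fun i _ => hA _ _)

lemma adjugate [Fintype m] [DecidableEq m] {A : X → Matrix m m ℂ} (hA : EntriesIn R A) :
    EntriesIn R fun x => (A x).adjugate := by
  intro i j
  simp only [Matrix.adjugate_apply]
  refine det (A := fun x => (A x).updateRow j (Pi.single i 1)) fun r s => ?_
  by_cases h : r = j
  · subst h
    simp only [Matrix.updateRow_self]
    exact R.algebraMap_mem _
  · simp only [Matrix.updateRow_ne h]
    exact hA r s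

lemma diagBlock {q d : ℕ} {A : X → Mat (q * d)} (hA : EntriesIn R A) (b : Fin q) :
    EntriesIn R fun x => diagBlock (A x) b :=
  fun _ _ => hA _ _

lemma blockDiag {q d : ℕ} {A : X → Fin q → Matrix (Fin d) (Fin d) ℂ}
    (hA : ∀ b, EntriesIn R fun x => A x b) : EntriesIn R fun x => blockDiag (A x) := by
  intro r s
  obtain ⟨b, i, rfl⟩ := exists_idx r
  obtain ⟨b', i', rfl⟩ := exists_idx s
  simp only [blockDiag_idx]
  split_ifs with h
  · exact hA b i i'
  · exact R.zero_mem

end EntriesIn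

/-! ### The principal nilpotent orbit of the Levi subgroup -/

section PrincipalOrbit

variable {q d : ℕ}

/-- Two block diagonal matrices with regular nilpotent blocks are conjugate under `L`. -/
lemma exists_levi_conj (hq : 0 < q) (hd : 0 < d) {M N : Fin q → Matrix (Fin d) (Fin d) ℂ}
    (hM : ∀ b, IsNilpotent (M b) ∧ M b ^ (d - 1) ≠ 0)
    (hN : ∀ b, IsNilpotent (N b) ∧ N b ^ (d - 1) ≠ 0) :
    ∃ l ∈ levi (q * d) d, blockDiag N = Ad l (blockDiag M) := by
  choose g hg hgM using fun b => exists_conj_jordan (hM b).1 (hM b).2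
  choose h hh hhN using fun b => exists_conj_jordan (hN b).1 (hN b).2
  have hgi : ∀ b, g b * (g b)⁻¹ = 1 := fun b => Matrix.mul_nonsing_inv _ (hg b).isUnit
  have hgi' : ∀ b, (g b)⁻¹ * g b = 1 := fun b => Matrix.nonsing_inv_mul _ (hg b).isUnit
  have hconj : ∀ b, h b * (g b)⁻¹ * M b = N b * (h b * (g b)⁻¹) := by
    intro b
    rw [← mul_assoc (N b), hhN, mul_assoc (h b), mul_assoc (h b)]
    congr 1
    calc (g b)⁻¹ * M b = (g b)⁻¹ * (M b * g b) * (g b)⁻¹ := by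
          rw [mul_assoc, mul_assoc, hgi, mul_one]
      _ = jordan d * (g b)⁻¹ := by rw [hgM, ← mul_assoc, hgi', one_mul]
  set k := blockDiag fun b => h b * (g b)⁻¹ with hk
  have hkdet : k.det ≠ 0 := by
    rw [hk, det_blockDiag]
    refine Finset.prod_ne_zero_iff.2 fun b _ => ?_
    rw [Matrix.det_mul, Matrix.det_nonsing_inv, Ring.inverse_eq_inv']
    exact mul_ne_zero (hh b) (inv_ne_zero (hg b))
  obtain ⟨c, hc⟩ := IsAlgClosed.exists_pow_nat_eq (k.det)⁻¹ (n := q * d) (Nat.mul_pos hq hd)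
  have hdet : (c • k).det = 1 := by
    rw [Matrix.det_smul, Fintype.card_fin, hc, inv_mul_cancel₀ hkdet]
  have hck : c • k = blockDiag fun b => c • (h b * (g b)⁻¹) := by
    rw [hk]
    ext r s
    obtain ⟨b, i, rfl⟩ := exists_idx r
    obtain ⟨b', i', rfl⟩ := exists_idx s
    rw [Matrix.smul_apply, blockDiag_idx, blockDiag_idx]
    split_ifs <;> simp
  refine ⟨⟨c • k, hdet⟩, mem_levi_of_coe_eq_blockDiag hck, ?_⟩
  have e : (c • k) * blockDiag M = blockDiag N * (c • k) := by
    rw [Matrix.smul_mul, Matrix.mul_smul, hk, ← blockDiag_mul, ← blockDiag_mul]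
    simp only [hconj]
  exact (Ad_eq_of_mul_eq (g := ⟨c • k, hdet⟩) e).symm

/-- The principal orbit consists of the block diagonal matrices with regular nilpotent blocks. -/
lemma mem_principalOrbitL_iff (hq : 0 < q) (hd : 0 < d) {y : Mat (q * d)}
    (hy : y ∈ nilconeL (q * d) d) : y ∈ principalOrbitL (q * d) d ↔ BlockRegular y := by
  open SpaceWithFunctions in
  constructor
  · rintro ⟨-, hcl⟩ b h0
    -- the regular blocks at `b` form an open set that meets `𝒩_L`
    have hJ : blockDiag (fun _ : Fin q => jordan d) ∈ nilconeL (q * d) d :=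
      blockDiag_mem_nilconeL hd fun _ => (jordan_isStrictUpper d).isNilpotent
    obtain ⟨i, j, hij⟩ : ∃ i j, (jordan d ^ (d - 1)) i j ≠ 0 := by
      by_contra! h
      exact jordan_pow_ne_zero hd (Matrix.ext h)
    have hreg : EntriesIn (regular (entries (n := q * d)) Set.univ) fun x => x :=
      fun r s => coord_mem_regular _ (r, s)
    have hopen := isOpen_nonvanishing (@isOpen_univ _ (zariski (entries (n := q * d))).top)
      ((hreg.diagBlock b).pow (d - 1) i j)
    obtain ⟨-, ⟨-, hz⟩, l, hl, rfl⟩ := (@mem_closure_iff _ (zariski _).top _ _).1 (hcl hJ) _ hopen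
      ⟨trivial, by beta_reduce; rwa [diagBlock_blockDiag]⟩
    beta_reduce at hz
    rw [diagBlock_Ad_pow hl.1 (fun r s h => hy.1.1 r s (ne_of_gt h)), h0] at hz
    simp at hz
  · intro hreg
    refine ⟨hy, fun z hz => ?_⟩
    rw [@mem_closure_iff _ (zariski _).top]
    intro o ho hzo
    obtain ⟨p, hp, hp'⟩ := isOpen_zariski_iff.1 ho z hzo
    have hznil := (isNilpotent_blockDiag_iff hd _).1 (eq_blockDiag_of_mem_nilconeL hz ▸ hz.2)
    have hynil := (isNilpotent_blockDiag_iff hd _).1 (eq_blockDiag_of_mem_nilconeL hy ▸ hy.2)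
    choose W hW using fun b => exists_regular_line hd (hznil b)
    have hcont : Continuous fun ε : ℂ => MvPolynomial.eval
        (entries (blockDiag fun b => diagBlock z b + ε • W b)) p := by
      refine (MvPolynomial.continuous_eval p).comp (continuous_pi fun rs => ?_)
      obtain ⟨b, i, h1⟩ := exists_idx rs.1
      obtain ⟨b', i', h2⟩ := exists_idx rs.2
      simp only [entries, h1, h2, blockDiag_idx]
      split_ifs
      · simp only [Matrix.add_apply, Matrix.smul_apply]
        fun_prop
      · exact continuous_const
    have hnear : ∀ᶠ ε : ℂ in 𝓝[≠] 0, MvPolynomial.eval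
        (entries (blockDiag fun b => diagBlock z b + ε • W b)) p ≠ 0 := by
      refine Filter.Eventually.filter_mono nhdsWithin_le_nhds (hcont.continuousAt.eventually_ne ?_)
      simpa [← eq_blockDiag_of_mem_nilconeL hz] using hp
    obtain ⟨ε, h1, h2⟩ := (hnear.and (Filter.eventually_all.2 hW)).exists
    obtain ⟨l, hl, hlz⟩ := exists_levi_conj hq hd (fun b => ⟨hynil b, hreg b⟩) h2
    refine ⟨_, hp' _ h1, l, hl, ?_⟩
    rw [hlz, ← eq_blockDiag_of_mem_nilconeL hy]

lemma mem_principalOrbitL_add_iff (hq : 0 < q) (hd : 0 < d) {x : Mat (q * d)}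
    (hx : x ∈ nilconeL (q * d) d + nilradicalP (q * d) d) :
    x ∈ principalOrbitL (q * d) d + nilradicalP (q * d) d ↔ BlockRegular x := by
  have hblock : ∀ y w : Mat (q * d), w ∈ nilradicalP (q * d) d → ∀ b,
      diagBlock (y + w) b = diagBlock y b := by
    intro y w hw b
    ext i j
    rw [diagBlock_apply, Matrix.add_apply, hw _ _ (by rw [blk_idx, blk_idx]), add_zero]
    rfl
  constructor
  · rintro ⟨y, hy, w, hw, rfl⟩ b
    rw [hblock y w hw]
    exact (mem_principalOrbitL_iff hq hd hy.1).1 hy b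
  · obtain ⟨y, hy, w, hw, rfl⟩ := hx
    intro h
    refine ⟨y, (mem_principalOrbitL_iff hq hd hy).2 fun b => ?_, w, hw, rfl⟩
    rw [← hblock y w hw]
    exact h b

end PrincipalOrbit

/-! ### The fibres of `ρ_P` over the regular stratum -/

/-- An element of `P` that conjugates an element `x` of `𝔲` with nonzero entries just above the
diagonal of the blocks into `𝔲` lies in `B`: it has to preserve the kernels of the powers of the
diagonal blocks of `x`, and these form the standard flags. -/
lemma mem_borel_of_mul_eq {n d : ℕ} (hd : 0 < d) {x x' : Mat n} (hx : x ∈ nilradical n)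
    (hreg : ∀ k : Fin (n - 1), ¬ d ∣ (k : ℕ) + 1 → projAd x k ≠ 0) (hx' : x' ∈ nilradical n)
    {h : SL n} (hh : h ∈ parabolic n d) (he : x * (h : Mat n) = (h : Mat n) * x') :
    h ∈ borel n := by
  have hP : ∀ r s, blk d s < blk d r → (h : Mat n) r s = 0 := fun r s => @hh r s
  -- induction on the column, and within a column from the bottom upwards
  have key : ∀ N : ℕ, ∀ s : Fin n, (s : ℕ) = N → ∀ m : ℕ, ∀ r : Fin n, s < r →
      n ≤ (r : ℕ) + m → (h : Mat n) r s = 0 := by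
    intro N
    induction N using Nat.strong_induction_on with
    | _ N ihN =>
    intro s hs m
    induction m with
    | zero => intro r _ hr; exact absurd r.2 (by omega)
    | succ m ihm =>
      intro r hsr hr
      have hsr' : (s : ℕ) < r := hsr
      by_cases hblk : blk d s < blk d r
      · exact hP r s hblk
      have hrn := r.2
      set i : Fin n := ⟨r - 1, by omega⟩ with hi
      have hiv : (i : ℕ) = r - 1 := rfl
      have h1 := congrFun (congrFun he i) s
      rw [Matrix.mul_apply, Matrix.mul_apply, Finset.sum_eq_single r, Finset.sum_eq_zero] at h1
      · refine (mul_eq_zero.1 h1).resolve_left ?_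
        have hk : ¬ d ∣ ((r : ℕ) - 1) + 1 := by
          rw [Nat.sub_add_cancel (by omega)]
          rintro ⟨c, hc⟩
          refine hblk ?_
          rw [blk, blk, hc, Nat.mul_div_cancel_left _ hd]
          exact Nat.div_lt_of_lt_mul (by omega)
        have := hreg ⟨r - 1, by omega⟩ hk
        have er : (⟨(r : ℕ) - 1 + 1, by omega⟩ : Fin n) = r :=
          Fin.ext (show (r : ℕ) - 1 + 1 = r by omega)
        change x i ⟨(r : ℕ) - 1 + 1, by omega⟩ ≠ 0 at this
        rwa [er] at this
      · intro l _
        by_cases hl : (l : ℕ) < s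
        · rw [ihN l (by omega) l rfl n i (Fin.lt_def.2 (by omega)) (by omega), zero_mul]
        · rw [hx' l s (Fin.le_def.2 (by omega)), mul_zero]
      · intro l _ hl
        have hl' : (l : ℕ) ≠ r := fun e => hl (Fin.ext e)
        by_cases hlr : (l : ℕ) < r
        · rw [hx i l (Fin.le_def.2 (by omega)), zero_mul]
        · rw [ihm l (Fin.lt_def.2 (by omega)) (by omega), mul_zero]
      · exact fun hk => absurd (Finset.mem_univ _) hk
  intro r s hrs
  exact key s s rfl n r hrs (by omega)

lemma Mixed.mk_eq_mk {G : Type*} [Group G] {H : Subgroup G} {M : Type*} [MulAction H M]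
    {a b : G × M} : Mixed.mk H a = Mixed.mk H b ↔ ∃ h : H, b = (a.1 * h, h⁻¹ • a.2) :=
  Quotient.eq (r := mixedSetoid H M)

lemma Mixed.mk_surjective {G : Type*} [Group G] {H : Subgroup G} {M : Type*} [MulAction H M] :
    Function.Surjective (Mixed.mk H : G × M → Mixed H M) :=
  Quotient.mk_surjective

section LocalLift

variable {q d : ℕ}

lemma mk_mem_NTildePReg (hq : 0 < q) (hd : 0 < d) (g : SL (q * d))
    (x : (nilconeL (q * d) d + nilradicalP (q * d) d : Set (Mat (q * d)))) :
    Mixed.mk (parabolic (q * d) d) (g, x) ∈ NTildePReg (q * d) d ↔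
      BlockRegular (x : Mat (q * d)) := by
  constructor
  · rintro ⟨g', x', hx', he⟩
    obtain ⟨h, hh⟩ := Mixed.mk_eq_mk.1 he.symm
    have e : (x : Mat (q * d)) = Ad ((h⁻¹ : parabolic (q * d) d) : SL (q * d)) x' :=
      congrArg (fun p => (p.2 : Mat (q * d))) hh
    rw [e]
    exact ((mem_principalOrbitL_add_iff hq hd x'.2).1 hx').conj (h⁻¹).2
      ((mem_add_iff _).1 x'.2).1
  · exact fun hx => ⟨g, x, (mem_principalOrbitL_add_iff hq hd x.2).2 hx, rfl⟩

lemma rhoP_mk (g : SL (q * d)) (x : nilradical (q * d)) :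
    rhoP (q * d) d (Mixed.mk _ (g, x)) =
      Mixed.mk _ (g, Set.inclusion (nilradical_subset (q * d) d) x) := rfl

lemma mk_mem_preimage_NTildePReg (hq : 0 < q) (hd : 0 < d) (g : SL (q * d))
    (x : nilradical (q * d)) :
    Mixed.mk (borel (q * d)) (g, x) ∈ rhoP (q * d) d ⁻¹' NTildePReg (q * d) d ↔
      ∀ k : Fin (q * d - 1), ¬ d ∣ (k : ℕ) + 1 → projAd (x : Mat (q * d)) k ≠ 0 := by
  rw [Set.mem_preimage, rhoP_mk, mk_mem_NTildePReg hq hd, ← blockRegular_iff_projAd hd x.2]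

lemma injOn_rhoP (hq : 0 < q) (hd : 0 < d) :
    Set.InjOn (rhoP (q * d) d) (rhoP (q * d) d ⁻¹' NTildePReg (q * d) d) := by
  intro a ha a' ha' he
  obtain ⟨⟨g, x⟩, rfl⟩ := Mixed.mk_surjective a
  obtain ⟨⟨g', x'⟩, rfl⟩ := Mixed.mk_surjective a'
  rw [mk_mem_preimage_NTildePReg hq hd] at ha
  obtain ⟨h, hh⟩ := Mixed.mk_eq_mk.1 he
  have e1 : g' = g * h := congrArg Prod.fst hh
  have e2 : (x' : Mat (q * d)) = Ad (h : SL (q * d))⁻¹ x :=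
    congrArg (fun p => (p.2 : Mat (q * d))) hh
  have e3 : (x : Mat (q * d)) * ((h : SL (q * d)) : Mat (q * d)) =
      ((h : SL (q * d)) : Mat (q * d)) * x' := by
    rw [e2, Ad, inv_inv, ← mul_assoc, ← mul_assoc, coe_mul_inv, one_mul]
  have hB := mem_borel_of_mul_eq hd x.2 ha x'.2 h.2 e3
  exact Mixed.mk_eq_mk.2 ⟨⟨h, hB⟩, Prod.ext e1 (Subtype.ext e2)⟩

/-- Given a choice `j` of a standard basis vector in each block, the block diagonal matrix whose
columns are obtained from these vectors by applying the powers of the diagonal blocks of `x`. -/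
def cyclicBlocks (j : Fin q → Fin d) (x : Mat (q * d)) : Mat (q * d) :=
  blockDiag fun b => cyclicMatrix (diagBlock x b) (j b)

/-- The diagonal matrix with entries `c, 1, …, 1`. -/
def firstScale (n : ℕ) (c : ℂ) : Mat n := Matrix.diagonal fun i => if (i : ℕ) = 0 then c else 1

lemma det_firstScale {n : ℕ} (hn : 0 < n) (c : ℂ) : (firstScale n c).det = c := by
  rw [firstScale, Matrix.det_diagonal, Finset.prod_eq_single ⟨0, hn⟩]
  · simp
  · intro i _ hi
    rw [if_neg fun e => hi (Fin.ext e)]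
  · exact fun hk => absurd (Finset.mem_univ _) hk

lemma firstScale_blockTriangular (n d : ℕ) (c : ℂ) :
    (firstScale n c).BlockTriangular (blk d) :=
  Matrix.blockTriangular_diagonal _

/-- The matrix `cyclicBlocks j x`, with its first column rescaled so that the determinant is `1`
(if it was nonzero). In contrast to dividing by an `n`-th root, this is a regular function. -/
def cyclicConjugator (j : Fin q → Fin d) (x : Mat (q * d)) : Mat (q * d) :=
  cyclicBlocks j x * firstScale (q * d) (cyclicBlocks j x).det⁻¹

lemma blockRegular_of_det_cyclicBlocks_ne_zero (hd : 0 < d) {j : Fin q → Fin d} {x : Mat (q * d)}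
    (h : (cyclicBlocks j x).det ≠ 0) : BlockRegular x := by
  intro b h0
  rw [cyclicBlocks, det_blockDiag, Finset.prod_ne_zero_iff] at h
  refine h b (Finset.mem_univ _) (Matrix.det_eq_zero_of_column_eq_zero ⟨0, hd⟩ fun i => ?_)
  simp [cyclicMatrix, h0]

/-- `cyclicConjugator j x` conjugates `x` into `𝔲`. -/
lemma exists_cyclicConjugator (hq : 0 < q) (hd : 0 < d) {j : Fin q → Fin d} {x : Mat (q * d)}
    (hx : x ∈ nilconeL (q * d) d + nilradicalP (q * d) d) (h : (cyclicBlocks j x).det ≠ 0) :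
    ∃ g : SL (q * d), (g : Mat (q * d)) = cyclicConjugator j x ∧ g ∈ parabolic (q * d) d ∧
      Ad g⁻¹ x ∈ nilradical (q * d) := by
  have hdet : (cyclicConjugator j x).det = 1 := by
    rw [cyclicConjugator, Matrix.det_mul, det_firstScale (Nat.mul_pos hq hd), mul_inv_cancel₀ h]
  have hKb : (cyclicBlocks j x).BlockTriangular (blk d) := blockDiag_blockTriangular _
  have hgP : (⟨cyclicConjugator j x, hdet⟩ : SL (q * d)) ∈ parabolic (q * d) d :=
    hKb.mul (firstScale_blockTriangular _ _ _)
  refine ⟨⟨cyclicConjugator j x, hdet⟩, rfl, hgP, ?_⟩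
  set g : SL (q * d) := ⟨cyclicConjugator j x, hdet⟩ with hg
  set z := Ad g⁻¹ x with hz
  obtain ⟨hxb, hxn⟩ := (mem_add_iff_diagBlock hd).1 hx
  have hzb : z.BlockTriangular (blk d) := Ad_blockTriangular (inv_mem hgP) hxb
  have hgz : (g : Mat (q * d)) * z = x * (g : Mat (q * d)) := by
    rw [hz, Ad, inv_inv, ← mul_assoc, ← mul_assoc, coe_mul_inv, one_mul]
  intro r s hsr
  by_cases hlt : blk d s < blk d r
  · exact hzb hlt
  obtain ⟨b, i, rfl⟩ := exists_idx r
  obtain ⟨b', k, rfl⟩ := exists_idx s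
  have hbb : b = b' := by
    have := Nat.div_le_div_right (c := d) (Fin.le_def.1 hsr)
    change blk d _ ≤ blk d _ at this
    rw [blk_idx, blk_idx] at this hlt
    exact Fin.ext (by omega)
  subst hbb
  have hki : k ≤ i := by
    have := Fin.le_def.1 hsr
    rw [coe_idx, coe_idx] at this
    exact Fin.le_def.2 (by omega)
  -- in the block `b`: `M E z = x M E = M J E` with `M` invertible and `E` diagonal
  set M := cyclicMatrix (diagBlock x b) (j b) with hM
  set E := diagBlock (firstScale (q * d) (cyclicBlocks j x).det⁻¹) b with hE
  have hMdet : M.det ≠ 0 := by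
    rw [cyclicBlocks, det_blockDiag, Finset.prod_ne_zero_iff] at h
    exact h b (Finset.mem_univ _)
  have hgb : diagBlock (g : Mat (q * d)) b = M * E := by
    change diagBlock (cyclicConjugator j x) b = _
    rw [cyclicConjugator, diagBlock_mul hKb (firstScale_blockTriangular _ _ _)]
    congr 1
    exact diagBlock_blockDiag _ b
  have e1 : M * (E * diagBlock z b) = M * (jordan d * E) := by
    rw [← mul_assoc, ← mul_assoc, ← hgb, ← diagBlock_mul hgP hzb, hgz, diagBlock_mul hxb hgP, hgb,
      ← mul_assoc, hM, mul_cyclicMatrix (pow_eq_zero_of_isNilpotent (hxn b))]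
  have e2 : E * diagBlock z b = jordan d * E := by
    have := congrArg (fun A => M⁻¹ * A) e1
    simpa only [← mul_assoc, Matrix.nonsing_inv_mul _ hMdet.isUnit, one_mul] using this
  have hEd : E = Matrix.diagonal fun i : Fin d =>
      if (idx b i : ℕ) = 0 then (cyclicBlocks j x).det⁻¹ else 1 := by
    ext i k
    rw [hE, diagBlock_apply, firstScale]
    by_cases hik : i = k
    · subst hik; simp
    · rw [Matrix.diagonal_apply_ne _ hik, Matrix.diagonal_apply_ne]
      rwa [Ne, idx_inj, and_iff_right rfl]
  have e3 := congrFun (congrFun e2 i) k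
  rw [hEd, Matrix.diagonal_mul, Matrix.mul_diagonal, jordan_isStrictUpper d i k hki, zero_mul] at e3
  refine (mul_eq_zero.1 e3).resolve_left ?_
  split_ifs
  · exact inv_ne_zero h
  · exact one_ne_zero

lemma entriesIn_firstScale {X : Type*} {n : ℕ} {R : Subalgebra ℂ (X → ℂ)} {f : X → ℂ}
    (hf : f ∈ R) : EntriesIn R fun x => firstScale n (f x) := by
  intro i k
  by_cases hik : i = k
  · subst hik
    simp only [firstScale, Matrix.diagonal_apply_eq]
    split_ifs
    · exact hf
    · exact R.one_mem
  · simp only [firstScale, Matrix.diagonal_apply_ne _ hik]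
    exact R.zero_mem

open SpaceWithFunctions in
/-- `ρ_P` maps the preimage of the regular stratum isomorphically onto this stratum. -/
lemma mapsIsomorphicallyOnto_rhoP (hq : 0 < q) (hd : 0 < d) :
    MapsIsomorphicallyOnto (varietyNTilde (q * d)) (varietyNTildeP (q * d) d) (rhoP (q * d) d)
      (rhoP (q * d) d ⁻¹' NTildePReg (q * d) d) (NTildePReg (q * d) d) := by
  refine mapsIsomorphicallyOnto_of_local_lifts Mixed.mk_surjective ?_ (fun _ h => h)
    (injOn_rhoP hq hd) ?_
  · refine isMorphism_quotient
      (s := fun p => (p.1, Set.inclusion (nilradical_subset (q * d) d) p.2)) ?_ fun _ => rfl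
    rintro (i | i)
    · exact coord_mem_regular _ (Sum.inl i)
    · exact coord_mem_regular _ (Sum.inr i)
  · rintro ⟨g₀, x₀⟩ hy
    rw [mk_mem_NTildePReg hq hd] at hy
    have hx₀ := (mem_add_iff_diagBlock hd).1 x₀.2
    have hex : ∀ b, ∃ r j, (diagBlock (x₀ : Mat (q * d)) b ^ (d - 1)) r j ≠ 0 := by
      intro b
      by_contra! h
      exact hy b (Matrix.ext h)
    choose r j hrj using hex
    let X := SL (q * d) × (nilconeL (q * d) d + nilradicalP (q * d) d : Set (Mat (q * d)))
    let c : X → (Fin (q * d) × Fin (q * d)) ⊕ (Fin (q * d) × Fin (q * d)) → ℂ := pairEntries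
    let δ : X → ℂ := fun y => (cyclicBlocks j (y.2 : Mat (q * d))).det
    have hgreg : ∀ U, EntriesIn (regular c U) fun y => (y.1 : Mat (q * d)) :=
      fun U a b => coord_mem_regular U (Sum.inl (a, b))
    have hxreg : ∀ U, EntriesIn (regular c U) fun y => (y.2 : Mat (q * d)) :=
      fun U a b => coord_mem_regular U (Sum.inr (a, b))
    have hKreg : ∀ U, EntriesIn (regular c U) fun y => cyclicBlocks j (y.2 : Mat (q * d)) :=
      fun U => EntriesIn.blockDiag fun b a k => ((hxreg U).diagBlock b).pow _ a (j b)
    let U : Set X := {y | y ∈ Set.univ ∧ δ y ≠ 0}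
    have hU : IsOpen[(zariski c).top] U :=
      isOpen_nonvanishing (@isOpen_univ _ (zariski c).top) (hKreg Set.univ).det
    have hHreg : EntriesIn (regular c U) fun y => cyclicConjugator j (y.2 : Mat (q * d)) :=
      (hKreg U).mul (entriesIn_firstScale (inv_mem_regular (hKreg U).det fun y hy => hy.2))
    have hlift : ∀ y : X, ∃ z : SL (q * d) × nilradical (q * d), y ∈ U →
        (z.1 : Mat (q * d)) = y.1 * cyclicConjugator j (y.2 : Mat (q * d)) ∧
        (z.2 : Mat (q * d)) = (cyclicConjugator j (y.2 : Mat (q * d))).adjugate * y.2 *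
          cyclicConjugator j (y.2 : Mat (q * d)) ∧
        rhoP (q * d) d (Mixed.mk _ z) = Mixed.mk _ (y.1, y.2) := by
      rintro ⟨g, x⟩
      by_cases hδ : δ (g, x) ≠ 0
      · obtain ⟨h, hh, hhP, hhx⟩ := exists_cyclicConjugator hq hd x.2 hδ
        refine ⟨(g * h, ⟨_, hhx⟩), fun _ => ⟨by rw [← hh]; simp, ?_, ?_⟩⟩
        · change Ad h⁻¹ (x : Mat (q * d)) = _
          rw [Ad, inv_inv, Matrix.SpecialLinearGroup.coe_inv, hh]
        · exact Eq.symm (Mixed.mk_eq_mk.2 ⟨⟨h, hhP⟩, rfl⟩)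
      · exact ⟨(1, ⟨0, fun _ _ _ => rfl⟩), fun h => absurd h.2 hδ⟩
    choose s hs using hlift
    refine ⟨U, s, hU, ⟨trivial, ?_⟩, ?_, fun y hy => ?_⟩
    · change (cyclicBlocks j (x₀ : Mat (q * d))).det ≠ 0
      rw [cyclicBlocks, det_blockDiag, Finset.prod_ne_zero_iff]
      exact fun b _ => det_cyclicMatrix_ne_zero (pow_eq_zero_of_isNilpotent (hx₀.2 b)) (hrj b)
    · rintro (i | i)
      · refine regular_congr ((hgreg U).mul hHreg i.1 i.2) fun y hy => ?_
        exact congrFun (congrFun (hs y hy).1 i.1) i.2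
      · refine regular_congr ((hHreg.adjugate.mul (hxreg U)).mul hHreg i.1 i.2) fun y hy => ?_
        exact congrFun (congrFun (hs y hy).2.1 i.1) i.2
    · refine ⟨?_, (hs y hy).2.2⟩
      rw [Set.mem_preimage, (hs y hy).2.2]
      exact (mk_mem_NTildePReg hq hd y.1 y.2).2 (blockRegular_of_det_cyclicBlocks_ne_zero hd hy.2)

end LocalLift

/-! ### The monoid of characters in the root cone -/

section Weights

variable {n : ℕ}

lemma weight_add (a b : Fin n → ℤ) : weight (a + b) = weight a * weight b :=
  (Finset.prod_congr rfl fun i _ => zpow_add (eps i) (a i) (b i)).trans Finset.prod_mul_distrib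

lemma weight_zero : weight (0 : Fin n → ℤ) = 1 :=
  Finset.prod_eq_one fun i _ => zpow_zero (eps i)

lemma map_nsmul_of_map_add {A M : Type*} [AddMonoid A] [Monoid M] {f : A → M} (h0 : f 0 = 1)
    (hadd : ∀ a b, f (a + b) = f a * f b) (m : ℕ) (a : A) : f (m • a) = f a ^ m := by
  induction m with
  | zero => rw [zero_smul, h0, pow_zero]
  | succ m ih => rw [succ_nsmul, hadd, ih, pow_succ]

lemma weight_sum {ι : Type*} (s : Finset ι) (f : ι → Fin n → ℤ) :
    weight (∑ k ∈ s, f k) = ∏ k ∈ s, weight (f k) := by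
  classical
  induction s using Finset.induction_on with
  | empty => simp [weight_zero]
  | insert k s hk ih => rw [Finset.sum_insert hk, Finset.prod_insert hk, weight_add, ih]

lemma weight_const (m : ℤ) : weight (fun _ : Fin n => m) = 1 := by
  ext t
  rw [coe_weight, Finset.prod_zpow]
  have h : ∏ i, (t : SL n) i i = 1 := by
    have h1 := (t : SL n).2
    have h2 : ((t : SL n) : Mat n).IsDiag := t.2
    rw [← h2.diagonal_diag, Matrix.det_diagonal] at h1
    exact h1
  rw [h, one_zpow]
  rfl

/-- The sum of the first `k` entries of the vector `a`. -/
def partialSum {R : Type*} [AddCommMonoid R] (a : Fin n → R) (k : ℕ) : R :=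
  ∑ i : Fin n, if (i : ℕ) < k then a i else 0

/-- For a vector `a` that represents `∑ k, c k α_k` modulo constant vectors, the coefficient of
the simple root with index `k` is `c k = rootCoeff a (k + 1) / n`. -/
def rootCoeff (a : Fin n → ℤ) (k : ℕ) : ℤ := n * partialSum a k - k * ∑ i, a i

lemma partialSum_succ (a : Fin n → ℤ) (j : Fin n) :
    partialSum a (j + 1) = partialSum a j + a j := by
  have : ∀ i : Fin n, (if (i : ℕ) < j + 1 then a i else 0) =
      (if (i : ℕ) < j then a i else 0) + if i = j then a j else 0 := by
    intro i
    rcases lt_trichotomy (i : ℕ) j with h | h | h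
    · have : i ≠ j := fun e => by simp [e] at h
      simp [h, this, Nat.lt_succ_of_lt h]
    · obtain rfl := Fin.ext h
      simp
    · have h1 : i ≠ j := fun e => by simp [e] at h
      have h2 : ¬ (i : ℕ) < j + 1 := by omega
      have h3 : ¬ (i : ℕ) < j := by omega
      simp [h1, h2, h3]
  simp only [partialSum, this, Finset.sum_add_distrib]
  simp

lemma partialSum_top {R : Type*} [AddCommMonoid R] (a : Fin n → R) : partialSum a n = ∑ i, a i :=
  Finset.sum_congr rfl fun i _ => if_pos i.2

lemma partialSum_zero {R : Type*} [AddCommMonoid R] (a : Fin n → R) : partialSum a 0 = 0 :=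
  Finset.sum_eq_zero fun _ _ => if_neg (Nat.not_lt_zero _)

lemma rootCoeff_add (a b : Fin n → ℤ) (k : ℕ) :
    rootCoeff (a + b) k = rootCoeff a k + rootCoeff b k := by
  have : partialSum (a + b) k = partialSum a k + partialSum b k := by
    rw [partialSum, partialSum, partialSum, ← Finset.sum_add_distrib]
    exact Finset.sum_congr rfl fun i _ => by split_ifs <;> simp
  simp only [rootCoeff, this, Pi.add_apply, Finset.sum_add_distrib]
  ring

lemma sum_rootExp_mul (k : Fin (n - 1)) (f : Fin n → ℤ) :
    ∑ i, rootExp k i * f i = f ⟨k, by omega⟩ - f ⟨k + 1, by omega⟩ := by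
  rw [Finset.sum_eq_add (⟨k, by omega⟩ : Fin n) ⟨k + 1, by omega⟩]
  · simp [rootExp, sub_eq_add_neg]
  · simp
  · intro c _ hc
    have h1 : (c : ℕ) ≠ k := fun h => hc.1 (Fin.ext h)
    have h2 : (c : ℕ) ≠ k + 1 := fun h => hc.2 (Fin.ext h)
    simp [rootExp, h1, h2]
  all_goals exact fun h => absurd (Finset.mem_univ _) h

lemma sum_rootExp (l : Fin (n - 1)) : ∑ i, rootExp l i = 0 := by
  simpa using sum_rootExp_mul l fun _ => 1

lemma partialSum_rootExp (l k : Fin (n - 1)) :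
    partialSum (rootExp l) ((k : ℕ) + 1) = if l = k then 1 else 0 := by
  have h := sum_rootExp_mul l fun i => if (i : ℕ) < k + 1 then 1 else 0
  simp only [mul_ite, mul_one, mul_zero] at h
  rw [partialSum, h]
  rcases lt_trichotomy (l : ℕ) k with h | h | h
  · have : l ≠ k := fun e => by simp [e] at h
    simp [this, h, Nat.lt_succ_of_lt h]
  · obtain rfl := Fin.ext h
    simp
  · have h1 : l ≠ k := fun e => by simp [e] at h
    have h2 : ¬ (l : ℕ) < k + 1 := by omega
    have h3 : ¬ (l : ℕ) < k := by omega
    simp [h1, h2, h3]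

lemma rootCoeff_rootExp (l k : Fin (n - 1)) :
    rootCoeff (rootExp l) ((k : ℕ) + 1) = if l = k then (n : ℤ) else 0 := by
  rw [rootCoeff, partialSum_rootExp, sum_rootExp]
  split_ifs <;> simp

/-- `n • a` is a constant vector plus an integral combination of the simple roots. -/
lemma nsmul_eq (a : Fin n → ℤ) : n • a = (fun _ => ∑ i, a i) +
    ∑ k : Fin (n - 1), rootCoeff a ((k : ℕ) + 1) • rootExp k := by
  funext j
  have hn := j.pos
  have h0 : rootCoeff a 0 = 0 := by simp [rootCoeff, partialSum_zero]
  have hN : rootCoeff a n = 0 := by simp [rootCoeff, partialSum_top]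
  have hstep : rootCoeff a (j + 1) - rootCoeff a j = n * a j - ∑ i, a i := by
    simp only [rootCoeff, partialSum_succ]
    push_cast
    ring
  have hterm : ∀ k : Fin (n - 1), rootCoeff a ((k : ℕ) + 1) * rootExp k j =
      (if (k : ℕ) = j then rootCoeff a (j + 1) else 0) -
        if (k : ℕ) + 1 = j then rootCoeff a j else 0 := by
    intro k
    by_cases h1 : (j : ℕ) = k
    · simp [rootExp, h1]
    · by_cases h2 : (j : ℕ) = k + 1
      · simp [rootExp, h2]
      · simp [rootExp, h1, h2, Ne.symm h1, Ne.symm h2]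
  have hA : ∑ k : Fin (n - 1), (if (k : ℕ) = j then rootCoeff a (j + 1) else 0) =
      rootCoeff a (j + 1) := by
    by_cases hj : (j : ℕ) < n - 1
    · rw [Finset.sum_eq_single ⟨j, hj⟩]
      · simp
      · intro k _ hk
        exact if_neg fun e => hk (Fin.ext e)
      · exact fun h => absurd (Finset.mem_univ _) h
    · have := j.2
      rw [show (j : ℕ) + 1 = n by omega, hN]
      simp
  have hB : ∑ k : Fin (n - 1), (if (k : ℕ) + 1 = j then rootCoeff a j else 0) =
      rootCoeff a j := by
    by_cases hj : (j : ℕ) = 0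
    · rw [hj, h0]
      simp
    · have hj2 := j.2
      rw [Finset.sum_eq_single ⟨j - 1, by omega⟩]
      · exact if_pos (show (j : ℕ) - 1 + 1 = j by omega)
      · intro k _ hk
        exact if_neg fun e => hk (Fin.ext (show (k : ℕ) = j - 1 by omega))
      · exact fun h => absurd (Finset.mem_univ _) h
  simp only [Pi.add_apply, Finset.sum_apply, Pi.smul_apply, smul_eq_mul, nsmul_eq_mul, hterm,
    Finset.sum_sub_distrib, hA, hB, hstep]
  ring

lemma inRootCone_iff (hn : 0 < n) {a : Fin n → ℤ} :
    InRootCone a ↔ ∀ k : Fin (n - 1), 0 ≤ rootCoeff a ((k : ℕ) + 1) := by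
  have hn' : (0 : ℝ) < n := by exact_mod_cast hn
  constructor
  · rintro ⟨c, s, hc, ha⟩ k
    have hsum : ((∑ i, a i : ℤ) : ℝ) = n * s := by
      push_cast
      simp only [ha, Finset.sum_add_distrib]
      rw [Finset.sum_comm]
      have : ∀ l : Fin (n - 1), ∑ i, c l * (rootExp l i : ℝ) = 0 := fun l => by
        rw [← Finset.mul_sum, ← Int.cast_sum, sum_rootExp, Int.cast_zero, mul_zero]
      simp [this]
    have hpart : ((partialSum a ((k : ℕ) + 1) : ℤ) : ℝ) = (k + 1) * s + c k := by
      have hkn : (k : ℕ) + 1 ≤ n := by omega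
      have h1 : ∀ i : Fin n, (((if (i : ℕ) < k + 1 then a i else 0 : ℤ)) : ℝ) =
          (if (i : ℕ) < k + 1 then s else 0) +
          ∑ l, c l * ((if (i : ℕ) < k + 1 then rootExp l i else 0 : ℤ) : ℝ) := by
        intro i
        split_ifs
        · exact ha i
        · simp
      have h2 : ∀ l : Fin (n - 1), ∑ i : Fin n,
          c l * ((if (i : ℕ) < k + 1 then rootExp l i else 0 : ℤ) : ℝ) =
            if l = k then c l else 0 := by
        intro l
        rw [← Finset.mul_sum, ← Int.cast_sum]
        have := partialSum_rootExp l k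
        rw [partialSum] at this
        rw [this]
        split_ifs <;> simp
      have h3 : ∑ i : Fin n, (if (i : ℕ) < k + 1 then s else 0) = (k + 1) * s := by
        rw [Fin.sum_univ_eq_sum_range (fun i => if i < (k : ℕ) + 1 then s else 0) n,
          ← Finset.sum_filter]
        have : (Finset.range n).filter (· < (k : ℕ) + 1) = Finset.range (k + 1) := by
          ext i; simp; omega
        rw [this]
        simp
      rw [partialSum, Int.cast_sum]
      simp only [h1, Finset.sum_add_distrib, h3]
      rw [Finset.sum_comm]
      simp only [h2]
      simp
    have : ((rootCoeff a ((k : ℕ) + 1) : ℤ) : ℝ) = n * c k := by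
      rw [rootCoeff]
      push_cast at hsum hpart ⊢
      rw [hsum, hpart]
      ring
    have h0 : (0 : ℝ) ≤ (rootCoeff a ((k : ℕ) + 1) : ℤ) := by
      rw [this]; exact mul_nonneg hn'.le (hc k)
    exact_mod_cast h0
  · intro h
    refine ⟨fun k => rootCoeff a ((k : ℕ) + 1) / n, (∑ i, a i : ℤ) / n,
      fun k => div_nonneg (by exact_mod_cast h k) hn'.le, fun j => ?_⟩
    have e := congrFun (nsmul_eq a) j
    simp only [Pi.add_apply, Finset.sum_apply, Pi.smul_apply, smul_eq_mul, nsmul_eq_mul] at e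
    have e' : (n : ℝ) * a j = (∑ i, a i : ℤ) +
        ∑ k : Fin (n - 1), (rootCoeff a ((k : ℕ) + 1) : ℝ) * (rootExp k j : ℝ) := by
      exact_mod_cast e
    have h3 : ∑ k : Fin (n - 1), (rootCoeff a ((k : ℕ) + 1) : ℝ) / n * (rootExp k j : ℝ) =
        (∑ k : Fin (n - 1), (rootCoeff a ((k : ℕ) + 1) : ℝ) * (rootExp k j : ℝ)) / n := by
      rw [Finset.sum_div]
      exact Finset.sum_congr rfl fun k _ => by ring
    rw [h3, ← add_div, ← e']
    field_simp

/-- A vector `e` with entries of sum zero is a cocharacter of `T`; this is its pairing with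
characters, evaluated at `2`. -/
lemma exists_torus_weight (e : Fin n → ℤ) (he : ∑ i, e i = 0) :
    ∃ t : torus n, ∀ a : Fin n → ℤ, ((weight a t : ℂˣ) : ℂ) = 2 ^ ∑ i, e i * a i := by
  have hdet : (Matrix.diagonal fun i => (2 : ℂ) ^ e i).det = 1 := by
    rw [Matrix.det_diagonal]
    have : ∏ i, (2 : ℂ) ^ e i = 2 ^ ∑ i, e i := by
      induction (Finset.univ : Finset (Fin n)) using Finset.induction_on with
      | empty => simp
      | insert k s hk ih =>
        rw [Finset.prod_insert hk, Finset.sum_insert hk, zpow_add₀ two_ne_zero, ih]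
    rw [this, he, zpow_zero]
  refine ⟨⟨⟨_, hdet⟩, Matrix.isDiag_diagonal _⟩, fun a => ?_⟩
  rw [coe_weight]
  have : ∀ s : Finset (Fin n), ∏ i ∈ s, ((2 : ℂ) ^ e i) ^ a i = 2 ^ ∑ i ∈ s, e i * a i := by
    intro s
    induction s using Finset.induction_on with
    | empty => simp
    | insert k s hk ih =>
      rw [Finset.prod_insert hk, Finset.sum_insert hk, zpow_add₀ two_ne_zero, ih, zpow_mul]
  rw [← this]
  exact Finset.prod_congr rfl fun i _ => by simp

lemma rootCoeff_eq_of_weight_eq {a b : Fin n → ℤ} (h : weight a = weight b) {k : ℕ}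
    (hk : k ≤ n) : rootCoeff a k = rootCoeff b k := by
  set e : Fin n → ℤ := fun i => (if (i : ℕ) < k then (n : ℤ) else 0) - k with he
  have hsum : ∀ c : Fin n → ℤ, ∑ i, e i * c i = rootCoeff c k := by
    intro c
    simp only [he, sub_mul, Finset.sum_sub_distrib, Finset.mul_sum, rootCoeff, partialSum,
      ite_mul, mul_ite, zero_mul, mul_zero]
  have h1 : ∑ i, e i = 0 := by
    simp only [he, Finset.sum_sub_distrib]
    rw [Fin.sum_univ_eq_sum_range (fun i => if i < k then (n : ℤ) else 0) n, ← Finset.sum_filter]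
    have : (Finset.range n).filter (· < k) = Finset.range k := by
      ext i; simp; omega
    rw [this]
    simp [mul_comm]
  obtain ⟨t, ht⟩ := exists_torus_weight e h1
  have h2 : (2 : ℂ) ^ rootCoeff a k = 2 ^ rootCoeff b k := by
    rw [← hsum, ← hsum, ← ht, ← ht, h]
  have h3 : (2 : ℝ) ^ rootCoeff a k = 2 ^ rootCoeff b k := by
    simpa only [norm_zpow, Complex.norm_ofNat] using congrArg norm h2
  exact zpow_right_injective₀ (by norm_num) (by norm_num) h3

/-- An integer `A` is the sum of the entries of a vector in the root cone that involves only those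
simple roots whose index does not satisfy `n ∣ (k + 1) A`: the partial sums are obtained by rounding
`k A / n` up. -/
lemma exists_inRootCone_sum_eq (hn : 0 < n) (A : ℤ) : ∃ a : Fin n → ℤ, InRootCone a ∧
    ∑ i, a i = A ∧ ∀ k : Fin (n - 1), (n : ℤ) ∣ ((k : ℕ) + 1 : ℕ) * A →
      rootCoeff a ((k : ℕ) + 1) = 0 := by
  have hn' : (0 : ℤ) < n := by exact_mod_cast hn
  set C : ℕ → ℤ := fun k => -((-(k * A)) / n) with hC
  set a : Fin n → ℤ := fun i => C (i + 1) - C i with ha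
  have hpart : ∀ k ≤ n, partialSum a k = C k := by
    intro k hk
    rw [partialSum, Fin.sum_univ_eq_sum_range (fun i => if i < k then C (i + 1) - C i else 0) n,
      ← Finset.sum_filter]
    have : (Finset.range n).filter (· < k) = Finset.range k := by
      ext i; simp; omega
    rw [this, Finset.sum_range_sub]
    simp [hC]
  have hsum : ∑ i, a i = A := by
    rw [← partialSum_top, hpart n le_rfl]
    simp only [hC]
    rw [← mul_neg, Int.mul_ediv_cancel_left _ hn'.ne', neg_neg]
  have hcoeff : ∀ k ≤ n, rootCoeff a k = -(k * A) - n * ((-(k * A)) / n) := by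
    intro k hk
    rw [rootCoeff, hpart k hk, hsum]
    simp only [hC]
    ring
  refine ⟨a, (inRootCone_iff hn).2 fun k => ?_, hsum, fun k hk => ?_⟩
  · rw [hcoeff _ (by omega)]
    exact sub_nonneg.2 (Int.mul_ediv_self_le hn'.ne')
  · rw [hcoeff _ (by omega), Int.mul_ediv_cancel' ((dvd_neg).2 hk), sub_self]

end Weights

/-! ### The toric variety `𝒱` -/

section Toric

variable {n : ℕ}

/-- A character in the cone, as an element of the monoid. -/
def coneWeight (a : Fin n → ℤ) (ha : InRootCone a) : coneMonoid n := ⟨weight a, a, ha, rfl⟩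

/-- A point of `𝒱` is nonzero on a character if and only if it is nonzero on all the simple roots
that occur in this character. -/
lemma val_coneWeight_ne_zero_iff (hn : 0 < n) (v : ToricV n) {a : Fin n → ℤ} (ha : InRootCone a) :
    v.val (coneWeight a ha) ≠ 0 ↔
      ∀ k : Fin (n - 1), rootCoeff a ((k : ℕ) + 1) ≠ 0 → piV v k ≠ 0 := by
  have hpos := (inRootCone_iff hn).1 ha
  have key : coneWeight a ha ^ n =
      ∏ k : Fin (n - 1), simpleRoot k ^ (rootCoeff a ((k : ℕ) + 1)).toNat := by
    apply Subtype.ext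
    rw [SubmonoidClass.coe_pow, SubmonoidClass.coe_finsetProd]
    have hpow := map_nsmul_of_map_add (M := torus n →* ℂˣ) (f := weight (n := n)) weight_zero
      weight_add
    simp only [SubmonoidClass.coe_pow, coneWeight, simpleRoot, ← hpow]
    rw [nsmul_eq, weight_add, weight_const, weight_sum]
    refine (one_mul (M := torus n →* ℂˣ) _).trans (Finset.prod_congr rfl fun k _ => ?_)
    congr 1
    rw [← natCast_zsmul, Int.toNat_of_nonneg (hpos k)]
  have h2 : v.val (coneWeight a ha) ^ n =
      ∏ k : Fin (n - 1), piV v k ^ (rootCoeff a ((k : ℕ) + 1)).toNat := by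
    rw [← map_pow, key, map_prod]
    simp only [map_pow, piV]
  rw [← pow_ne_zero_iff hn.ne', h2, Finset.prod_ne_zero_iff]
  refine forall_congr' fun k => ?_
  have := hpos k
  simp only [Finset.mem_univ, true_imp_iff]
  by_cases h0 : rootCoeff a ((k : ℕ) + 1) = 0
  · simp [h0]
  · rw [pow_ne_zero_iff (by omega)]
    simp [h0]

/-- `π : 𝒱 → 𝒱_ad` is surjective. -/
lemma piV_surjective (hn : 0 < n) : Function.Surjective (piV : ToricV n → VAd n) := by
  intro x
  choose r hr using fun k => IsAlgClosed.exists_pow_nat_eq (x k) hn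
  choose a ha haw using fun s : coneMonoid n => s.2
  -- the exponent of the root with index `k` in the `n`-th power of the character `s`
  let m : coneMonoid n → Fin (n - 1) → ℕ := fun s k => (rootCoeff (a s) ((k : ℕ) + 1)).toNat
  have hm : ∀ (s : coneMonoid n) (b : Fin n → ℤ), weight b = s → ∀ k,
      (m s k : ℤ) = rootCoeff b ((k : ℕ) + 1) := by
    intro s b hb k
    rw [Int.toNat_of_nonneg ((inRootCone_iff hn).1 (ha s) k)]
    exact rootCoeff_eq_of_weight_eq ((haw s).trans hb.symm) (by omega)
  refine ⟨⟨{
    toFun := fun s => ∏ k, r k ^ m s k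
    map_one' := ?_
    map_mul' := fun s t => ?_ }⟩, ?_⟩
  · refine Finset.prod_eq_one fun k _ => ?_
    have := hm 1 0 weight_zero k
    rw [show m 1 k = 0 by simpa [rootCoeff, partialSum] using this, pow_zero]
  · rw [← Finset.prod_mul_distrib]
    refine Finset.prod_congr rfl fun k _ => ?_
    rw [← pow_add]
    congr 1
    have h1 := hm (s * t) (a s + a t) (by rw [weight_add, haw, haw]; rfl) k
    rw [rootCoeff_add, ← hm s _ (haw s), ← hm t _ (haw t)] at h1
    exact_mod_cast h1
  · funext k
    change ∏ l, r l ^ m (simpleRoot k) l = x k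
    have h1 : ∀ l, m (simpleRoot k) l = if k = l then n else 0 := by
      intro l
      have := hm (simpleRoot k) (rootExp k) rfl l
      rw [rootCoeff_rootExp] at this
      split_ifs at this ⊢ <;> exact_mod_cast this
    simp only [h1, pow_ite, pow_zero]
    simp [hr]

/-! ### Stabilizers in the center -/

/-- The center of `SL_n` is generated by a scalar matrix `ζ`, with `ζ` a primitive root of unity. -/
lemma exists_center_generator (hn : 0 < n) : ∃ (ζ : ℂ) (z₀ : Subgroup.center (SL n)),
    IsPrimitiveRoot ζ n ∧ ((z₀ : SL n) : Mat n) = Matrix.scalar (Fin n) ζ ∧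
      ∀ z, ∃ j : ℕ, z = z₀ ^ j := by
  have : NeZero n := ⟨hn.ne'⟩
  have hζ := Complex.isPrimitiveRoot_exp n hn.ne'
  set ζ := Complex.exp (2 * Real.pi * Complex.I / n)
  have hz₀ : (⟨Matrix.scalar (Fin n) ζ, by simp [hζ.pow_eq_one]⟩ : SL n) ∈
      Subgroup.center (SL n) :=
    Matrix.SpecialLinearGroup.mem_center_iff.2 ⟨ζ, by simpa using hζ.pow_eq_one, rfl⟩
  refine ⟨ζ, ⟨_, hz₀⟩, hζ, rfl, fun z => ?_⟩
  obtain ⟨r, hr, hrz⟩ := Matrix.SpecialLinearGroup.mem_center_iff.1 z.2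
  rw [Fintype.card_fin] at hr
  obtain ⟨j, -, hj⟩ := hζ.eq_pow_of_pow_eq_one hr
  refine ⟨j, Subtype.ext (Subtype.ext ?_)⟩
  rw [← hrz, ← hj, map_pow, SubmonoidClass.coe_pow, Matrix.SpecialLinearGroup.coe_pow]

/-- The point `[g, (v, x)]` is fixed by a central element if and only if the characters on which
`v` is nonzero are trivial at this element. -/
lemma center_smul_eq_iff {z : Subgroup.center (SL n)} {r : ℂ}
    (hz : ((z : SL n) : Mat n) = Matrix.scalar (Fin n) r) (hr : r ≠ 0) (g : SL n) (u : UTilde n) :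
    (z : SL n) • Mixed.mk (borel n) (g, u) = Mixed.mk (borel n) (g, u) ↔
      ∀ (a : Fin n → ℤ) (ha : InRootCone a), u.1.1.val (coneWeight a ha) ≠ 0 →
        r ^ ∑ i, a i = 1 := by
  have hcomm : ∀ h : SL n, (z : SL n) * h = h * z := fun h =>
    (Subgroup.mem_center_iff.1 z.2 h).symm
  have hzB : (z : SL n) ∈ borel n := by
    intro i j hij
    rw [hz, Matrix.scalar_apply, Matrix.diagonal_apply_ne]
    rintro rfl
    exact lt_irrefl _ hij
  set b : borel n := ⟨z, hzB⟩ with hb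
  have h1 : (z : SL n) • Mixed.mk (borel n) (g, u) = Mixed.mk (borel n) (g, b • u) := by
    change Mixed.mk (borel n) ((z : SL n) * g, u) = _
    rw [Mixed.mk_eq_mk]
    refine ⟨b⁻¹, ?_⟩
    rw [inv_inv, hcomm]
    refine Prod.ext ?_ rfl
    change g = g * z * (z : SL n)⁻¹
    rw [mul_inv_cancel_right]
  have h2 : Mixed.mk (borel n) (g, b • u) = Mixed.mk (borel n) (g, u) ↔ b • u = u := by
    constructor
    · intro h
      obtain ⟨k, hk⟩ := Mixed.mk_eq_mk.1 h
      have e1 : g = g * k := congrArg Prod.fst hk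
      have e2 : u = k⁻¹ • b • u := congrArg Prod.snd hk
      have e3 : k = 1 := Subtype.ext (by simpa using e1)
      rw [e3, inv_one, one_smul] at e2
      exact e2.symm
    · intro h
      rw [h]
  have h3 : b • u = u ↔ b • u.1.1 = u.1.1 := by
    constructor
    · intro h
      exact congrArg (fun u : UTilde n => u.1.1) h
    · intro h
      refine Subtype.ext (Prod.ext h (Subtype.ext ?_))
      change Ad (z : SL n) (u.1.2 : Mat n) = u.1.2
      refine Ad_eq_of_mul_eq ?_
      rw [hz]
      exact (Matrix.scalar_commute r (fun _ => mul_comm _ _) _)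
  have hw : ∀ a : Fin n → ℤ, ((weight a (borelToTorus n b) : ℂˣ) : ℂ) = r ^ ∑ i, a i := by
    intro a
    have : ∀ i, ((borelToTorus n b : torus n) : SL n) i i = r := by
      intro i
      change Matrix.diagonal (fun i => ((z : SL n) : Mat n) i i) i i = r
      rw [hz]
      simp
    rw [coe_weight]
    simp only [this]
    have : ∀ s : Finset (Fin n), ∏ i ∈ s, r ^ a i = r ^ ∑ i ∈ s, a i := by
      intro s
      induction s using Finset.induction_on with
      | empty => simp
      | insert k s hk ih => rw [Finset.prod_insert hk, Finset.sum_insert hk, zpow_add₀ hr, ih]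
    exact this _
  rw [h1, h2, h3]
  constructor
  · intro h a ha hne
    have := congrArg (fun v : ToricV n => v.val (coneWeight a ha)) h
    change ((weight a (borelToTorus n b) : ℂˣ) : ℂ) * u.1.1.val (coneWeight a ha) =
      u.1.1.val (coneWeight a ha) at this
    rw [hw] at this
    exact (mul_eq_right₀ hne).1 this
  · intro h
    have : ∀ v : ToricV n, (∀ (a : Fin n → ℤ) (ha : InRootCone a), v.val (coneWeight a ha) ≠ 0 →
        r ^ ∑ i, a i = 1) → b • v = v := by
      rintro ⟨v⟩ hv
      refine congrArg ToricV.mk (MonoidHom.ext ?_)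
      rintro ⟨_, a, ha, rfl⟩
      change ((weight a (borelToTorus n b) : ℂˣ) : ℂ) * v (coneWeight a ha) = v (coneWeight a ha)
      rw [hw]
      by_cases h0 : v (coneWeight a ha) = 0
      · rw [h0, mul_zero]
      · rw [hv a ha h0, one_mul]
    exact this _ h

end Toric

/-! ### The stratum `Ñ_χ` -/

section Stratum

variable {n : ℕ}

lemma orderOf_dvd_and_pos (hn : 0 < n) (χ : Subgroup.center (SL n) →* ℂˣ) :
    orderOf χ ∣ n ∧ 0 < orderOf χ := by
  have h : χ ^ n = 1 := by
    refine MonoidHom.ext fun z => ?_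
    have hz : z ^ n = 1 := by
      obtain ⟨ζ, z₀, hζ, hz₀, hgen⟩ := exists_center_generator hn
      obtain ⟨j, rfl⟩ := hgen z
      refine Subtype.ext (Subtype.ext ?_)
      rw [← pow_mul, mul_comm, pow_mul]
      have : (((z₀ ^ n : Subgroup.center (SL n)) : SL n) : Mat n) = 1 := by
        rw [SubmonoidClass.coe_pow, Matrix.SpecialLinearGroup.coe_pow, hz₀, ← map_pow,
          hζ.pow_eq_one, map_one]
      have h1 : z₀ ^ n = 1 := Subtype.ext (Subtype.ext this)
      rw [h1, one_pow]
    rw [MonoidHom.pow_apply, ← map_pow, hz, map_one, MonoidHom.one_apply]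
  have hd := orderOf_dvd_of_pow_eq_one (x := χ) (n := n) h
  exact ⟨hd, Nat.pos_of_dvd_of_pos hd hn⟩

/-- The stabilizer condition that defines `M̃_χ`, in terms of the point of `𝒱_ad`. -/
lemma mk_mem_MTildeChi_iff (hn : 0 < n) (χ : Subgroup.center (SL n) →* ℂˣ) (g : SL n)
    (u : UTilde n) : Mixed.mk (borel n) (g, u) ∈ MTildeChi χ ↔
      ∀ k : Fin (n - 1), ¬ orderOf χ ∣ (k : ℕ) + 1 → piV u.1.1 k ≠ 0 := by
  obtain ⟨ζ, z₀, hζ, hz₀, hgen⟩ := exists_center_generator hn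
  obtain ⟨hdn, hd⟩ := orderOf_dvd_and_pos hn χ
  have hζ0 : ζ ≠ 0 := hζ.ne_zero hn.ne'
  have hpow : ∀ j : ℕ, (((z₀ ^ j : Subgroup.center (SL n)) : SL n) : Mat n) =
      Matrix.scalar (Fin n) (ζ ^ j) := by
    intro j
    rw [SubmonoidClass.coe_pow, Matrix.SpecialLinearGroup.coe_pow, hz₀, ← map_pow]
  have hχ : ∀ e : ℕ, χ z₀ ^ e = 1 ↔ orderOf χ ∣ e := by
    intro e
    rw [orderOf_dvd_iff_pow_eq_one]
    constructor
    · intro h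
      refine MonoidHom.ext fun z => ?_
      obtain ⟨j, rfl⟩ := hgen z
      rw [MonoidHom.pow_apply, map_pow, ← pow_mul, mul_comm, pow_mul, h, one_pow,
        MonoidHom.one_apply]
    · intro h
      rw [← MonoidHom.pow_apply, h, MonoidHom.one_apply]
  constructor
  · -- if the coordinate with index `k` vanishes, then `ζ ^ gcd (n, k + 1)` fixes the point
    intro hm k hk hk0
    refine hk (((hχ _).1 ?_).trans (Nat.gcd_dvd_right n (k + 1)))
    rw [← map_pow]
    refine hm _ ((center_smul_eq_iff (hpow _) (pow_ne_zero _ hζ0) g u).2 fun a ha hne => ?_)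
    have h1 := (val_coneWeight_ne_zero_iff hn _ ha).1 hne k
    have h2 : rootCoeff a ((k : ℕ) + 1) = 0 := by
      by_contra h
      exact h1 h hk0
    rw [rootCoeff, sub_eq_zero] at h2
    rw [← zpow_natCast, ← zpow_mul, hζ.zpow_eq_one_iff_dvd, Nat.gcd_eq_gcd_ab, add_mul]
    refine dvd_add (by rw [mul_assoc]; exact dvd_mul_right _ _) ?_
    rw [mul_right_comm, ← h2, mul_assoc]
    exact dvd_mul_right _ _
  · -- a character on which the point does not vanish restricts to `ζ ↦ ζ ^ (n / d)`
    intro hreg z hz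
    obtain ⟨j, rfl⟩ := hgen z
    obtain ⟨a, ha, hsum, hcoeff⟩ := exists_inRootCone_sum_eq hn ((n / orderOf χ : ℕ) : ℤ)
    have hnd : orderOf χ * (n / orderOf χ) = n := Nat.mul_div_cancel' hdn
    have h1 := (center_smul_eq_iff (hpow j) (pow_ne_zero _ hζ0) g u).1 hz a ha
      ((val_coneWeight_ne_zero_iff hn _ ha).2 fun k hk => hreg k fun hdvd => hk (hcoeff k (by
        have : n ∣ ((k : ℕ) + 1) * (n / orderOf χ) :=
          hnd.symm.dvd.trans (Nat.mul_dvd_mul_right hdvd _)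
        exact_mod_cast this)))
    rw [hsum, zpow_natCast, ← pow_mul, hζ.pow_eq_one_iff_dvd] at h1
    have h2 : orderOf χ ∣ j := Nat.dvd_of_mul_dvd_mul_right
      (Nat.div_pos (Nat.le_of_dvd hn hdn) hd) (hnd.dvd.trans h1)
    rw [MonoidHom.mem_ker, map_pow]
    exact (hχ j).2 h2

lemma mk_mem_NTildeChi_iff (hn : 0 < n) (χ : Subgroup.center (SL n) →* ℂˣ) (g : SL n)
    (x : nilradical n) : Mixed.mk (borel n) (g, x) ∈ NTildeChi χ ↔
      ∀ k : Fin (n - 1), ¬ orderOf χ ∣ (k : ℕ) + 1 → projAd (x : Mat n) k ≠ 0 := by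
  constructor
  · rintro ⟨m, hm, he⟩ k hk
    obtain ⟨⟨g', u⟩, rfl⟩ := Mixed.mk_surjective m
    rw [mk_mem_MTildeChi_iff hn] at hm
    obtain ⟨b, hb⟩ := Mixed.mk_eq_mk.1 (he : Mixed.mk (borel n) (g', u.1.2) = _).symm
    have e : (u.1.2 : Mat n) = Ad ((b⁻¹ : borel n) : SL n) x :=
      congrArg (fun p => (p.2 : Mat n)) hb
    have h1 := hm k hk
    rw [u.2, e, projAd_Ad _ x.2] at h1
    exact right_ne_zero_of_mul h1
  · intro h
    obtain ⟨v, hv⟩ := piV_surjective hn (projAd (x : Mat n))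
    let u : UTilde n := ⟨(v, x), hv⟩
    refine ⟨Mixed.mk (borel n) (g, u), (mk_mem_MTildeChi_iff hn χ g u).2 fun k hk => ?_, rfl⟩
    change piV v k ≠ 0
    rw [hv]
    exact h k hk

end Stratum

end ExtendedSpringer

end

theorem proposition4p5 (n : ℕ) (hn : 0 < n) (d : ℕ)
    (χ : Subgroup.center (Matrix.SpecialLinearGroup (Fin n) ℂ) →* ℂˣ) (hχ : orderOf χ = d) :
    ExtendedSpringer.rhoP n d ⁻¹' ExtendedSpringer.NTildePReg n d = ExtendedSpringer.NTildeChi χ ∧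
    ExtendedSpringer.SpaceWithFunctions.MapsIsomorphicallyOnto
      (ExtendedSpringer.varietyNTilde n) (ExtendedSpringer.varietyNTildeP n d)
      (ExtendedSpringer.rhoP n d)
      (ExtendedSpringer.NTildeChi χ) (ExtendedSpringer.NTildePReg n d) := by
  obtain ⟨hdn, hd⟩ := ExtendedSpringer.orderOf_dvd_and_pos hn χ
  rw [hχ] at hdn hd
  obtain ⟨q, hq⟩ := hdn
  obtain rfl : n = q * d := hq.trans (mul_comm d q)
  have hq0 : 0 < q := Nat.pos_of_mul_pos_right hn
  have e : ExtendedSpringer.rhoP (q * d) d ⁻¹' ExtendedSpringer.NTildePReg (q * d) d =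
      ExtendedSpringer.NTildeChi χ := by
    ext m
    obtain ⟨⟨g, x⟩, rfl⟩ := ExtendedSpringer.Mixed.mk_surjective m
    rw [ExtendedSpringer.mk_mem_preimage_NTildePReg hq0 hd,
      ExtendedSpringer.mk_mem_NTildeChi_iff hn, hχ]
  refine ⟨e, ?_⟩
  rw [← e]
  exact ExtendedSpringer.mapsIsomorphicallyOnto_rhoP hq0 hd
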